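/- Trees are finite, rooted and ordered (the children of every node have a fixed left-to-right order). The degree of a node is its number of children; the degree of a tree is the maximum degree of its nodes. $T_c$ is the subtree rooted at $c$. A (poly-line) drawing of $T$ assigns to every node a point of the plane and to every edge a piecewise linear curve between its ends, such that all nodes and bends have integral $x$-coordinates. It is planar if distinct nodes lie at distinct points, edges are simple curves that contain no nodes other than their ends, and two edges meet only at common ends. It is upward if along every edge the $y$-coordinate does not increase from the parent to the child (horizontal segments are allowed). An upward drawing is order-preserving if at every node the edges to the children leave in the given left-to-right order. The width is the smallest $W$ such that, after a translation, all $x$-coordinates lie in $\{1,\dots,W\}$. The rooted pathwidth $rpw(T)$ is $1$ if $T$ is a single node, and otherwise $\min_{c_h}\max_c\{rpw(T_c)+\chi_{(c\neq c_h)}\}$, where $c_h$ and $c$ range over the children of the root and $\chi_{(c\ne c_h)}$ is $1$ if $c\neq c_h$ and $0$ otherwise. The rank $R(T)$ is $1$ if $T$ is a single node. Otherwise let $c_1,\dots,c_d$ be the children of the root from left to right; then $R(T)$ is the smallest $W\ge 1$ for which one can classify each child as big or small and choose an integer $1\le X\le W$ and a big child $c_v$ such that: at most $X-1$ big children are strictly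 left of $c_v$ and at most $W-X$ big children are strictly right of $c_v$; every small $c_i$ with $i<v$ satisfies $R(T_{c_i})\le X-1-\ell_i$, where $\ell_i$ is the number of big children left of $c_i$; every small $c_i$ with $i>v$ satisfies $R(T_{c_i})\le W-X-r_i$, where $r_i$ is the number of big children right of $c_i$; and there are pairwise distinct numbers $\pi(c)\in\{1,\dots,W\}$ for the big children $c$ with $R(T_c)\le\pi(c)$. **Theorem.** For every integer $i\ge 1$ there exists an ordered rooted tree $T_i$ of degree at most $5$, and of degree exactly $5$ if $i\ge 2$, such that 1. $T_i$ has a (not necessarily order-preserving) planar upward drawing of width $i$, and $rpw(T_i)\le i$; 2. $R(T_i)=2i-1$, and every planar order-preserving upward drawing of $T_i$ has width at least $2i-1$. -/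

import Mathlib

/-- Finite rooted trees in which the children of every node are ordered from left to right:
`node d c` has root with children `c 0, …, c (d - 1)`, in this order. -/
inductive PlaneTree : Type
  | node (d : ℕ) (c : Fin d → PlaneTree) : PlaneTree

namespace PlaneTree

/-- The nodes of a tree: the root, and the nodes of the subtrees rooted at its children. -/
inductive Node : PlaneTree → Type
  | root (T : PlaneTree) : Node T
  | sub {d : ℕ} {c : Fin d → PlaneTree} (i : Fin d) (u : Node (c i)) : Node (node d c)

/-- The degree of a node, i.e. its number of children. -/
def Node.deg : {T : PlaneTree} → Node T → ℕ
  | node d _, .root _ => d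
  | _, .sub _ u => u.deg

/-- The `i`-th child (from left to right) of a node. -/
def Node.child : {T : PlaneTree} → (u : Node T) → Fin u.deg → Node T
  | node _ c, .root _, i => .sub i (.root (c i))
  | _, .sub j u, i => .sub j (u.child i)

/-- An edge of a tree is given by its upper end `e.1` (the parent)
and the index `e.2` of the child at its lower end. -/
abbrev Edge (T : PlaneTree) : Type := Σ u : Node T, Fin u.deg

/-- The upper end of an edge. -/
def Edge.parent {T : PlaneTree} (e : Edge T) : Node T := e.1

/-- The lower end of an edge. -/
def Edge.child {T : PlaneTree} (e : Edge T) : Node T := e.1.child e.2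

/-- `w` is one of the two ends of `e`. -/
def Edge.Incident {T : PlaneTree} (e : Edge T) (w : Node T) : Prop :=
  w = e.parent ∨ w = e.child

/-- The rooted pathwidth: `1` for a single node, and otherwise the minimum over all children `h`
of the maximum over all children `i` of `rpw (c i)`, increased by one if `i ≠ h`. -/
def rpw : PlaneTree → ℕ
  | node 0 _ => 1
  | node (_ + 1) c =>
      Finset.univ.inf' Finset.univ_nonempty fun h =>
        Finset.univ.sup fun i => rpw (c i) + if i = h then 0 else 1

/-- `HasRankWitness r W`: there is a rank-`W`-witness for a tree whose root has `d` children
with ranks `r 0, …, r (d - 1)` from left to right. It consists of the set `big` of big children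
(the others are small), a coordinate `X` and the index `v` of the vertical child.
The inequalities are written without subtraction. -/
def HasRankWitness {d : ℕ} (r : Fin d → ℕ) (W : ℕ) : Prop :=
  ∃ (big : Finset (Fin d)) (X : ℕ) (v : Fin d),
    1 ≤ X ∧ X ≤ W ∧ v ∈ big ∧
    -- at most `X - 1` big children are strictly left of `v`
    (big.filter (· < v)).card + 1 ≤ X ∧
    -- at most `W - X` big children are strictly right of `v`
    (big.filter (v < ·)).card + X ≤ W ∧
    -- small children left of `v` have rank at most `X - 1 - #(big children left of them)`
    (∀ i, i ∉ big → i < v → r i + 1 + (big.filter (· < i)).card ≤ X) ∧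
    -- small children right of `v` have rank at most `W - X - #(big children right of them)`
    (∀ i, i ∉ big → v < i → r i + X + (big.filter (i < ·)).card ≤ W) ∧
    -- the big children have distinct rank-bounds in `{1, …, W}`
    ∃ π : Fin d → ℕ, Set.InjOn π big ∧ ∀ i ∈ big, 1 ≤ π i ∧ π i ≤ W ∧ r i ≤ π i

/-- The rank: `1` for a single node, and otherwise the smallest `W` for which there is a
rank-`W`-witness. -/
noncomputable def rank : PlaneTree → ℕ
  | node 0 _ => 1
  | node (_ + 1) c => sInf {W : ℕ | HasRankWitness (fun i => rank (c i)) W}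

end PlaneTree

/-- The point of the plane given by an integral `x`-coordinate and a real `y`-coordinate. -/
def toPlane (p : ℤ × ℝ) : ℝ × ℝ := ((p.1 : ℝ), p.2)

/-- The set of points on the poly-line with the given successive vertices. -/
def polyTrace : List (ℤ × ℝ) → Set (ℝ × ℝ)
  | [] => ∅
  | [p] => {toPlane p}
  | p :: q :: l => segment ℝ (toPlane p) (toPlane q) ∪ polyTrace (q :: l)

/-- The poly-line with the given successive vertices is a simple curve: no segment is degenerate,
and each segment meets the rest of the poly-line after it only in its own end point. -/
def SimplePoly : List (ℤ × ℝ) → Prop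
  | [] => True
  | [_] => True
  | p :: q :: l =>
      p ≠ q ∧ segment ℝ (toPlane p) (toPlane q) ∩ polyTrace (q :: l) ⊆ {toPlane q} ∧
        SimplePoly (q :: l)

/-- For nonzero vectors `a`, `b` in the closed lower half-plane: turning counterclockwise from the
leftward horizontal direction to the rightward one, `a` is met strictly before `b`. This means
that the cross product is positive, unless `a` points horizontally to the left and
`b` horizontally to the right. -/
def DirLeftOf (a b : ℝ × ℝ) : Prop :=
  0 < a.1 * b.2 - a.2 * b.1 ∨ (a.1 < 0 ∧ a.2 = 0 ∧ 0 < b.1 ∧ b.2 = 0)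

/-- A poly-line drawing of a tree: every node is placed at a point, and every edge is given by the
list of its bends, from its upper to its lower end. Nodes and bends have integral
`x`-coordinates. -/
structure PolyDrawing (T : PlaneTree) where
  pos : T.Node → ℤ × ℝ
  bends : T.Edge → List (ℤ × ℝ)

namespace PolyDrawing

variable {T : PlaneTree}

/-- The vertices of the poly-line that represents an edge, from the parent to the child. -/
def poly (D : PolyDrawing T) (e : T.Edge) : List (ℤ × ℝ) :=
  D.pos e.parent :: (D.bends e ++ [D.pos e.child])

/-- The curve that represents an edge. -/
def curve (D : PolyDrawing T) (e : T.Edge) : Set (ℝ × ℝ) := polyTrace (D.poly e)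

/-- The second vertex of the poly-line that represents an edge. -/
def second (D : PolyDrawing T) (e : T.Edge) : ℤ × ℝ :=
  (D.bends e ++ [D.pos e.child]).head (by simp)

/-- The direction in which an edge leaves the parent. -/
def dir (D : PolyDrawing T) (e : T.Edge) : ℝ × ℝ :=
  toPlane (D.second e) - toPlane (D.pos e.parent)

/-- The drawing is planar: distinct nodes are at distinct points, edges are simple curves, edges
contain no nodes except for their ends, and two edges meet only at common ends. -/
def IsPlanar (D : PolyDrawing T) : Prop :=
  Function.Injective D.pos ∧
  (∀ e, SimplePoly (D.poly e)) ∧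
  (∀ e w, toPlane (D.pos w) ∈ D.curve e → e.Incident w) ∧
  (∀ e f, e ≠ f → ∀ x ∈ D.curve e ∩ D.curve f,
    ∃ w, e.Incident w ∧ f.Incident w ∧ x = toPlane (D.pos w))

/-- The drawing is upward: along each edge, from parent to child, the `y`-coordinate never
increases (horizontal segments are allowed). -/
def IsUpward (D : PolyDrawing T) : Prop :=
  ∀ e, (D.poly e).Pairwise fun p q => q.2 ≤ p.2

/-- The (upward) drawing is order-preserving: at each node, the edges to the children leave in the
given order from left to right. -/
def IsOrderPreserving (D : PolyDrawing T) : Prop :=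
  ∀ (u : T.Node) (i j : Fin u.deg), i < j → DirLeftOf (D.dir ⟨u, i⟩) (D.dir ⟨u, j⟩)

/-- All nodes and bends lie in `W` consecutive columns. -/
def FitsColumns (D : PolyDrawing T) (W : ℕ) : Prop :=
  ∃ a : ℤ, (∀ u, a + 1 ≤ (D.pos u).1 ∧ (D.pos u).1 ≤ a + W) ∧
    ∀ e, ∀ p ∈ D.bends e, a + 1 ≤ p.1 ∧ p.1 ≤ a + W

/-- The width: the smallest `W` such that, after a translation, all `x`-coordinates are between
`1` and `W`. -/
noncomputable def width (D : PolyDrawing T) : ℕ := sInf {W : ℕ | D.FitsColumns W}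

end PolyDrawing

/-!
The tree for `i = 1` is a single node. From a tree `T` the next one, `fan T`, is obtained by giving
a new root five children: the middle one is `cherry T`, a node with two children that both carry
`T`, and the other four carry `T`. One step adds one to the rooted pathwidth and two to the rank;
it also adds two columns to what an order-preserving drawing needs.

*Unordered drawings.* Every tree has a planar upward straight-line drawing of width equal to its
rooted pathwidth (`PolyDrawing.exists_width_eq_rpw`): place the root in the first column, the
subtrees at its children one below the other, the one at a child that attains the minimum in the
definition of `rpw` last and directly below the root, the others from the second column on.

*Order-preserving drawings.* A path from the root of an upward drawing is a poly-line whose heights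
never increase. It meets every horizontal line within its range of heights in an interval, so the
points to its left and those to its right are two disjoint relatively open sets, and a connected set
that avoids it within this range lies on one side. Hence, if two branches at the root are compared,
a path to the lowest node of the branch that descends further has the other branch on one side, and
the order at the root tells on which (`fst_lt_of_dirLeftOf` and its mirror image). All vertices of
the other branch are then strictly beside some point of the path, and, having integral
`x`-coordinates, they avoid the first or the last column that the path's vertices occupy.

If `T` needs `n` columns, it follows that `cherry T` needs `n + 1`
(`PlaneTree.needsColumns_of_two`). Suppose that `fan T` is drawn in `n + 1` columns. Then the branch
of the middle child is the lowest one, and it has two copies of `T` on its left and two on its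
right. If the root is not in the last column, then the two branches on the left avoid the last
column altogether, and so do all paths to their nodes; so a path to the lower one of the two costs
the other one a second column, and only `n - 1` remain. Otherwise the same happens on the right
(`PlaneTree.needsColumns_of_five`).

*Rank.* Both ranks are computed from the definition (`PlaneTree.rank_cherry`,
`PlaneTree.rank_fan`): big children of rank at least `m` number at most `W + 1 - m`, since their
bounds are distinct elements of `{m, …, W}`.
-/

/-! ### Poly-lines -/

@[simp] theorem toPlane_fst (p : ℤ × ℝ) : (toPlane p).1 = p.1 := rfl

@[simp] theorem toPlane_snd (p : ℤ × ℝ) : (toPlane p).2 = p.2 := rfl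

theorem toPlane_injective : Function.Injective toPlane := by
  rintro ⟨a, b⟩ ⟨c, d⟩ h
  simpa [toPlane] using h

theorem toPlane_mem_polyTrace {p : ℤ × ℝ} : ∀ {l : List (ℤ × ℝ)}, p ∈ l → toPlane p ∈ polyTrace l
  | [q], h => by simp_all [polyTrace]
  | q :: r :: l, h => by
    rcases List.mem_cons.1 h with rfl | h
    · exact Or.inl (left_mem_segment ℝ _ _)
    · exact Or.inr (toPlane_mem_polyTrace h)

theorem polyTrace_subset_of_convex {C : Set (ℝ × ℝ)} (hC : Convex ℝ C) :
    ∀ {l : List (ℤ × ℝ)}, (∀ p ∈ l, toPlane p ∈ C) → polyTrace l ⊆ C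
  | [], _ => by simp [polyTrace]
  | [p], h => by simpa [polyTrace] using h
  | p :: q :: l, h => by
    refine Set.union_subset (hC.segment_subset (h p (by simp)) (h q (by simp))) ?_
    exact polyTrace_subset_of_convex hC fun r hr => h r (List.mem_cons_of_mem _ hr)

/-- Two poly-lines glued at a common vertex. -/
theorem polyTrace_append (p : ℤ × ℝ) (l₂ : List (ℤ × ℝ)) :
    ∀ l₁ : List (ℤ × ℝ),
      polyTrace (l₁ ++ p :: l₂) = polyTrace (l₁ ++ [p]) ∪ polyTrace (p :: l₂)
  | [] => by
    have h := toPlane_mem_polyTrace (p := p) (l := p :: l₂) (by simp)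
    simp [polyTrace, Set.insert_eq_of_mem h]
  | [q] => by
    have h := toPlane_mem_polyTrace (p := p) (l := p :: l₂) (by simp)
    have h' := right_mem_segment ℝ (toPlane q) (toPlane p)
    simp [polyTrace, Set.insert_eq_of_mem h']
  | q :: r :: l₁ => by
    have := polyTrace_append p l₂ (r :: l₁)
    simp only [List.cons_append, polyTrace] at this ⊢
    rw [this, Set.union_assoc]

theorem isCompact_segment_plane (a b : ℝ × ℝ) : IsCompact (segment ℝ a b) := by
  rw [segment_eq_image_lineMap]
  exact isCompact_Icc.image (AffineMap.lineMap_continuous)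

theorem isCompact_polyTrace : ∀ l : List (ℤ × ℝ), IsCompact (polyTrace l)
  | [] => isCompact_empty
  | [_] => isCompact_singleton
  | _ :: q :: l => (isCompact_segment_plane _ _).union (isCompact_polyTrace (q :: l))

theorem isPreconnected_polyTrace : ∀ l : List (ℤ × ℝ), IsPreconnected (polyTrace l)
  | [] => isPreconnected_empty
  | [_] => isPreconnected_singleton
  | p :: q :: l =>
    (convex_segment _ _).isPreconnected.union (toPlane q) (right_mem_segment ℝ _ _)
      (toPlane_mem_polyTrace (by simp)) (isPreconnected_polyTrace (q :: l))

/-- The condition of `PolyDrawing.IsUpward` on a single poly-line: heights never increase. -/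
abbrev Descending (l : List (ℤ × ℝ)) : Prop := l.Pairwise fun p q => q.2 ≤ p.2

theorem convex_le_fst (a : ℝ) : Convex ℝ {z : ℝ × ℝ | a ≤ z.1} :=
  convex_halfSpace_ge (LinearMap.fst ℝ ℝ ℝ).isLinear a

theorem convex_fst_le (a : ℝ) : Convex ℝ {z : ℝ × ℝ | z.1 ≤ a} :=
  convex_halfSpace_le (LinearMap.fst ℝ ℝ ℝ).isLinear a

theorem convex_le_snd (a : ℝ) : Convex ℝ {z : ℝ × ℝ | a ≤ z.2} :=
  convex_halfSpace_ge (LinearMap.snd ℝ ℝ ℝ).isLinear a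

theorem convex_snd_le (a : ℝ) : Convex ℝ {z : ℝ × ℝ | z.2 ≤ a} :=
  convex_halfSpace_le (LinearMap.snd ℝ ℝ ℝ).isLinear a

theorem Descending.snd_le {p : ℤ × ℝ} {l : List (ℤ × ℝ)} (h : Descending (p :: l)) {z : ℝ × ℝ}
    (hz : z ∈ polyTrace (p :: l)) : z.2 ≤ p.2 := by
  refine polyTrace_subset_of_convex (convex_snd_le p.2) ?_ hz
  intro q hq
  rcases List.mem_cons.1 hq with rfl | hq
  · exact le_refl (q.2)
  · exact (List.pairwise_cons.1 h).1 q hq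

/-- The points of a poly-line on a horizontal line form an interval if the heights never
increase. -/
theorem Descending.ordConnected_slice (y : ℝ) :
    ∀ {l : List (ℤ × ℝ)}, Descending l → {x : ℝ | (x, y) ∈ polyTrace l}.OrdConnected
  | [], _ => by simpa [polyTrace] using Set.ordConnected_empty
  | [p], _ => by
    refine ⟨fun x hx x' hx' t ht => ?_⟩
    simp only [polyTrace, Set.mem_singleton_iff, Set.mem_ofPred_eq, Prod.ext_iff] at hx hx' ⊢
    exact ⟨le_antisymm (hx'.1 ▸ ht.2) (hx.1 ▸ ht.1), hx.2⟩
  | p :: q :: l, h => by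
    have hs : {x : ℝ | (x, y) ∈ segment ℝ (toPlane p) (toPlane q)}.OrdConnected := by
      refine ⟨fun x hx x' hx' t ht => ?_⟩
      refine (convex_segment _ _).segment_subset hx hx' ?_
      rw [← segment_eq_Icc (ht.1.trans ht.2)] at ht
      obtain ⟨a, b, ha, hb, hab, rfl⟩ := ht
      refine ⟨a, b, ha, hb, hab, ?_⟩
      ext
      · simp
      · simp [← add_mul, hab]
    have h' : Descending (q :: l) := (List.pairwise_cons.1 h).2
    have ht := h'.ordConnected_slice y
    have hU : {x : ℝ | (x, y) ∈ polyTrace (p :: q :: l)} =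
        {x : ℝ | (x, y) ∈ segment ℝ (toPlane p) (toPlane q)} ∪
          {x : ℝ | (x, y) ∈ polyTrace (q :: l)} := rfl
    rw [hU]
    rcases Set.eq_empty_or_nonempty {x : ℝ | (x, y) ∈ segment ℝ (toPlane p) (toPlane q)} with
      h1 | ⟨x₁, h1⟩
    · rw [h1, Set.empty_union]; exact ht
    rcases Set.eq_empty_or_nonempty {x : ℝ | (x, y) ∈ polyTrace (q :: l)} with h2 | ⟨x₂, h2⟩
    · rw [h2, Set.union_empty]; exact hs
    -- both pieces meet the line, so it passes through their common point `q`
    have hy : y = q.2 := by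
      refine le_antisymm (h'.snd_le h2) ?_
      refine (convex_le_snd q.2).segment_subset (x := toPlane p) (y := toPlane q) ?_ ?_ h1
      · exact (List.pairwise_cons.1 h).1 q (by simp)
      · exact le_refl q.2
    subst hy
    rw [← isPreconnected_iff_ordConnected] at hs ht ⊢
    exact hs.union (q.1 : ℝ) (right_mem_segment ℝ _ _)
      (toPlane_mem_polyTrace (p := q) (by simp)) ht

/-- A poly-line meets every horizontal line between its start and one of its vertices. -/
theorem exists_mem_polyTrace_of_between {y : ℝ} :
    ∀ {p : ℤ × ℝ} {l : List (ℤ × ℝ)} {q : ℤ × ℝ}, q ∈ p :: l → q.2 ≤ y → y ≤ p.2 →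
      ∃ x : ℝ, (x, y) ∈ polyTrace (p :: l)
  | p, [], q, hq, h1, h2 => by
    obtain rfl : q = p := by simpa using hq
    exact ⟨q.1, by simp [polyTrace, toPlane, le_antisymm h2 h1]⟩
  | p, p' :: l, q, hq, h1, h2 => by
    by_cases hy : y ≤ p'.2
    · rcases List.mem_cons.1 hq with rfl | hq
      · exact ⟨q.1, by
          rw [le_antisymm h2 h1]
          exact toPlane_mem_polyTrace (p := q) (by simp)⟩
      · obtain ⟨x, hx⟩ := exists_mem_polyTrace_of_between hq h1 hy
        exact ⟨x, Or.inr hx⟩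
    · have h3 : y ∈ segment ℝ p.2 p'.2 := by
        rw [segment_symm, segment_eq_Icc (by linarith)]
        exact ⟨by linarith, h2⟩
      obtain ⟨a, b, ha, hb, hab, rfl⟩ := h3
      exact ⟨a * p.1 + b * p'.1, Or.inl ⟨a, b, ha, hb, hab, rfl⟩⟩

/-! ### Separation by a descending poly-line -/

/-- The points that lie strictly to the left of all points of `S` at the same height. -/
def leftOf (S : Set (ℝ × ℝ)) : Set (ℝ × ℝ) := {z | ∀ x, (x, z.2) ∈ S → z.1 < x}

/-- The points that lie strictly to the right of all points of `S` at the same height. -/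
def rightOf (S : Set (ℝ × ℝ)) : Set (ℝ × ℝ) := {z | ∀ x, (x, z.2) ∈ S → x < z.1}

open scoped Pointwise in
theorem isOpen_leftOf {S : Set (ℝ × ℝ)} (hS : IsCompact S) : IsOpen (leftOf S) := by
  have h : (leftOf S)ᶜ = S + (Set.Ici 0 ×ˢ {0} : Set (ℝ × ℝ)) := by
    ext ⟨z, y⟩
    simp only [leftOf, Set.mem_compl_iff, Set.mem_ofPred_eq, not_forall, not_lt, Set.mem_add]
    constructor
    · rintro ⟨x, hx, hxz⟩
      exact ⟨(x, y), hx, (z - x, 0), by simp [hxz], by simp⟩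
    · rintro ⟨⟨x, y'⟩, hx, ⟨t, s⟩, hts, he⟩
      simp only [Set.mem_prod, Set.mem_Ici, Set.mem_singleton_iff, Prod.mk_add_mk,
        Prod.mk.injEq] at hts he
      obtain ⟨ht, rfl⟩ := hts
      obtain ⟨rfl, rfl⟩ := he
      exact ⟨x, by simpa using hx, by linarith⟩
  rw [← isClosed_compl_iff, h]
  exact (isClosed_Ici.prod isClosed_singleton).add_left_of_isCompact hS

open scoped Pointwise in
theorem isOpen_rightOf {S : Set (ℝ × ℝ)} (hS : IsCompact S) : IsOpen (rightOf S) := by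
  have h : (rightOf S)ᶜ = S + (Set.Iic 0 ×ˢ {0} : Set (ℝ × ℝ)) := by
    ext ⟨z, y⟩
    simp only [rightOf, Set.mem_compl_iff, Set.mem_ofPred_eq, not_forall, not_lt, Set.mem_add]
    constructor
    · rintro ⟨x, hx, hxz⟩
      exact ⟨(x, y), hx, (z - x, 0), by simp [hxz], by simp⟩
    · rintro ⟨⟨x, y'⟩, hx, ⟨t, s⟩, hts, he⟩
      simp only [Set.mem_prod, Set.mem_Iic, Set.mem_singleton_iff, Prod.mk_add_mk,
        Prod.mk.injEq] at hts he
      obtain ⟨ht, rfl⟩ := hts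
      obtain ⟨rfl, rfl⟩ := he
      exact ⟨x, by simpa using hx, by linarith⟩
  rw [← isClosed_compl_iff, h]
  exact (isClosed_Iic.prod isClosed_singleton).add_left_of_isCompact hS

theorem Descending.mem_leftOf_or_mem_rightOf {l : List (ℤ × ℝ)} (h : Descending l) {z : ℝ × ℝ}
    (hz : z ∉ polyTrace l) : z ∈ leftOf (polyTrace l) ∨ z ∈ rightOf (polyTrace l) := by
  by_contra! hcon
  simp only [leftOf, rightOf, Set.mem_ofPred_eq, not_forall, not_lt] at hcon
  obtain ⟨⟨x, hx, hxz⟩, x', hx', hxz'⟩ := hcon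
  exact hz ((h.ordConnected_slice z.2).out hx hx' ⟨hxz, hxz'⟩)

/-- A connected set that avoids a descending poly-line, stays within its range of heights and
contains a point to its left lies to its left altogether. -/
theorem Descending.subset_leftOf {p : ℤ × ℝ} {l : List (ℤ × ℝ)} (h : Descending (p :: l))
    {A : Set (ℝ × ℝ)} (hA : IsPreconnected A) (hd : ∀ z ∈ A, z ∉ polyTrace (p :: l))
    {b : ℤ × ℝ} (hb : b ∈ p :: l) (hAb : ∀ z ∈ A, b.2 ≤ z.2) (hAp : ∀ z ∈ A, z.2 ≤ p.2)
    (hne : (A ∩ leftOf (polyTrace (p :: l))).Nonempty) : A ⊆ leftOf (polyTrace (p :: l)) := by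
  have hK := isCompact_polyTrace (p :: l)
  have hlr : ∀ z ∈ A, ¬(z ∈ leftOf (polyTrace (p :: l)) ∧ z ∈ rightOf (polyTrace (p :: l))) := by
    rintro z hz ⟨h1, h2⟩
    obtain ⟨x, hx⟩ := exists_mem_polyTrace_of_between hb (hAb z hz) (hAp z hz)
    exact lt_asymm (h1 x hx) (h2 x hx)
  rcases isPreconnected_iff_subset_of_disjoint.1 hA _ _ (isOpen_leftOf hK) (isOpen_rightOf hK)
    (fun z hz => h.mem_leftOf_or_mem_rightOf (hd z hz))
    (Set.eq_empty_of_forall_notMem fun z hz => hlr z hz.1 hz.2) with h1 | h1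
  · exact h1
  · obtain ⟨z, hz, hzl⟩ := hne
    exact absurd ⟨hzl, h1 hz⟩ (hlr z hz)

/-- A segment that starts at the start `o` of a descending poly-line and leaves to the left of it
has points to the left of it. -/
theorem exists_lineMap_mem_leftOf {o p q : ℤ × ℝ} {l : List (ℤ × ℝ)}
    (h : Descending (o :: p :: l)) (ho : toPlane o ∉ polyTrace (p :: l)) (hq : q.2 ≤ o.2)
    (hdir : DirLeftOf (toPlane q - toPlane o) (toPlane p - toPlane o)) :
    ∃ t ∈ Set.Ioc (0 : ℝ) 1,
      AffineMap.lineMap (toPlane o) (toPlane q) t ∈ leftOf (polyTrace (o :: p :: l)) := by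
  have h' : Descending (p :: l) := (List.pairwise_cons.1 h).2
  have hp : p.2 ≤ o.2 := (List.pairwise_cons.1 h).1 p (by simp)
  simp only [DirLeftOf, Prod.fst_sub, Prod.snd_sub, toPlane_fst, toPlane_snd] at hdir
  rcases hp.lt_or_eq with hlt | heq
  · -- at heights close to that of `o` the poly-line has only points of its first segment
    have hc : 0 ≤ o.2 - q.2 := by linarith
    have ha : 0 < o.2 - p.2 := by linarith
    have hs : 0 < (o.2 - p.2) + (o.2 - q.2) + 1 := by linarith
    set t : ℝ := (o.2 - p.2) / ((o.2 - p.2) + (o.2 - q.2) + 1) with ht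
    have ht0 : 0 < t := div_pos ha hs
    have ht1 : t ≤ 1 := (div_le_one hs).2 (by linarith)
    have htc : t * (o.2 - q.2) < o.2 - p.2 := by
      rw [ht, div_mul_eq_mul_div, div_lt_iff₀ hs]
      nlinarith
    refine ⟨t, ⟨ht0, ht1⟩, ?_⟩
    intro x hx
    simp only [AffineMap.lineMap_apply, vsub_eq_sub, vadd_eq_add, Prod.snd_add, Prod.smul_snd,
      Prod.snd_sub, toPlane_snd, smul_eq_mul, Prod.fst_add, Prod.smul_fst, Prod.fst_sub,
      toPlane_fst] at hx ⊢
    have hx' : (x, t * (q.2 - o.2) + o.2) ∈ segment ℝ (toPlane o) (toPlane p) := by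
      rcases hx with hx | hx
      · exact hx
      · have := h'.snd_le hx
        simp only at this
        linarith
    rw [segment_eq_image_lineMap] at hx'
    obtain ⟨s, -, hs'⟩ := hx'
    simp only [AffineMap.lineMap_apply, vsub_eq_sub, vadd_eq_add, Prod.ext_iff, Prod.snd_add,
      Prod.smul_snd, Prod.snd_sub, toPlane_snd, smul_eq_mul, Prod.fst_add, Prod.smul_fst,
      Prod.fst_sub, toPlane_fst] at hs'
    obtain ⟨rfl, hs2⟩ := hs'
    have hs3 : s * (p.2 - o.2) = t * (q.2 - o.2) := by linarith
    rcases hdir with hdir | hdir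
    · have h1 := mul_pos ht0 hdir
      have h2 : 0 < (s * ((p.1 : ℝ) - o.1) - t * (q.1 - o.1)) * (o.2 - p.2) := by
        linear_combination h1 + ((p.1 : ℝ) - o.1) * hs3
      have := pos_of_mul_pos_left h2 ha.le
      linarith
    · linarith [hdir.2.2.2]
  · -- the first segment is horizontal and goes right: near `o`, replace the poly-line by the rest
    have hpo : (o.1 : ℝ) < p.1 := by
      rcases hdir with hdir | hdir
      · rw [heq, sub_self, mul_zero, zero_sub, neg_pos] at hdir
        by_contra! hcon
        nlinarith [mul_nonneg (sub_nonneg.2 hq) (sub_nonneg.2 hcon)]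
      · linarith [hdir.2.2.1]
    have hmem : toPlane o ∈ leftOf (polyTrace (p :: l)) := by
      intro x hx
      by_contra! hcon
      refine ho ((h'.ordConnected_slice o.2).out hx (y := (p.1 : ℝ)) ?_ ⟨hcon, hpo.le⟩)
      change ((p.1 : ℝ), o.2) ∈ polyTrace (p :: l)
      rw [← heq]
      exact toPlane_mem_polyTrace (p := p) (by simp)
    have hopen := isOpen_leftOf (isCompact_polyTrace (p :: l))
    have hcont : Continuous (AffineMap.lineMap (toPlane o) (toPlane q) : ℝ → ℝ × ℝ) :=
      AffineMap.lineMap_continuous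
    have hnh : ∀ᶠ t in nhdsWithin (0 : ℝ) (Set.Ioi 0),
        AffineMap.lineMap (toPlane o) (toPlane q) t ∈ leftOf (polyTrace (p :: l)) := by
      refine Filter.Eventually.filter_mono nhdsWithin_le_nhds ?_
      refine hcont.continuousAt.eventually (hopen.mem_nhds ?_)
      simpa using hmem
    obtain ⟨t, ht, ht0⟩ := (hnh.and (Ioc_mem_nhdsGT (zero_lt_one' ℝ))).exists
    refine ⟨t, ht0, ?_⟩
    intro x hx
    rcases hx with hx | hx
    · simp only [AffineMap.lineMap_apply, vsub_eq_sub, vadd_eq_add, Prod.snd_add, Prod.smul_snd,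
        Prod.snd_sub, toPlane_snd, smul_eq_mul, Prod.fst_add, Prod.smul_fst, Prod.fst_sub,
        toPlane_fst] at hx ⊢
      have hx1 := (convex_le_fst (o.1 : ℝ)).segment_subset (x := toPlane o) (y := toPlane p)
        (le_refl (o.1 : ℝ)) hpo.le hx
      have hx2 := (convex_le_snd o.2).segment_subset (x := toPlane o) (y := toPlane p)
        (le_refl o.2) heq.ge hx
      simp only [Set.mem_ofPred_eq] at hx1 hx2
      have hqo : q.2 = o.2 := by
        by_contra hne
        have : q.2 < o.2 := lt_of_le_of_ne hq hne
        nlinarith [ht0.1]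
      have hq1 : (q.1 : ℝ) < o.1 := by
        rcases hdir with hdir | hdir
        · rw [heq, hqo] at hdir; simp at hdir
        · linarith [hdir.1]
      nlinarith [ht0.1]
    · exact ht x hx

/-- Let two descending poly-lines start at `o` and be disjoint otherwise. If the second one leaves
`o` to the left of the first one, and ends no lower, then all its vertices other than `o` are in
columns strictly to the left of the last column of the first one. -/
theorem fst_lt_of_dirLeftOf {o p q : ℤ × ℝ} {l m : List (ℤ × ℝ)}
    (hP : Descending (o :: p :: l)) (hQ : Descending (o :: q :: m))
    (hoP : toPlane o ∉ polyTrace (p :: l)) (hoQ : toPlane o ∉ polyTrace (q :: m))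
    (hPQ : ∀ z ∈ polyTrace (o :: p :: l), z ∈ polyTrace (o :: q :: m) → z = toPlane o)
    (hdir : DirLeftOf (toPlane q - toPlane o) (toPlane p - toPlane o))
    {b : ℤ × ℝ} (hb : b ∈ o :: p :: l) (hbQ : ∀ v ∈ q :: m, b.2 ≤ v.2)
    {M : ℤ} (hM : ∀ v ∈ o :: p :: l, v.1 ≤ M) {v : ℤ × ℝ} (hv : v ∈ q :: m) : v.1 < M := by
  have hq : q.2 ≤ o.2 := (List.pairwise_cons.1 hQ).1 q (by simp)
  have hb' : b.2 ≤ o.2 := (hbQ q (by simp)).trans hq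
  -- the second poly-line without its start
  set A : Set (ℝ × ℝ) :=
    (AffineMap.lineMap (toPlane o) (toPlane q) : ℝ → ℝ × ℝ) '' Set.Ioc 0 1 ∪ polyTrace (q :: m)
    with hAdef
  have hAsub : A ⊆ polyTrace (o :: q :: m) := by
    refine Set.union_subset_union_left _ ?_
    rw [segment_eq_image_lineMap]
    exact Set.image_mono Set.Ioc_subset_Icc_self
  have hAo : toPlane o ∉ A := by
    rintro (⟨t, ht, hto⟩ | h)
    · have hoq : toPlane o ≠ toPlane q := fun h => hoQ (h ▸ toPlane_mem_polyTrace (by simp))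
      rw [AffineMap.lineMap_eq_left_iff] at hto
      rcases hto with hto | hto
      · exact hoq hto
      · exact ht.1.ne' hto
    · exact hoQ h
  have hAconn : IsPreconnected A := by
    refine IsPreconnected.union (toPlane q) ⟨1, by simp, by simp⟩ (toPlane_mem_polyTrace (by simp))
      ?_ (isPreconnected_polyTrace _)
    exact isPreconnected_Ioc.image _ AffineMap.lineMap_continuous.continuousOn
  obtain ⟨t, ht, htl⟩ := exists_lineMap_mem_leftOf hP hoP hq hdir
  have hsub := hP.subset_leftOf hAconn (fun z hz hzP => hAo (hPQ z hzP (hAsub hz) ▸ hz)) hb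
    (fun z hz => polyTrace_subset_of_convex (convex_le_snd b.2)
      (by
        intro v hv
        rcases List.mem_cons.1 hv with rfl | hv
        · exact hb'
        · exact hbQ v hv) (hAsub hz))
    (fun z hz => hQ.snd_le (hAsub hz)) ⟨_, Or.inl ⟨t, ht, rfl⟩, htl⟩
  have hvl := hsub (Or.inr (toPlane_mem_polyTrace hv))
  obtain ⟨x, hx⟩ := exists_mem_polyTrace_of_between hb (hbQ v hv)
    ((List.pairwise_cons.1 hQ).1 v hv)
  have h1 : (v.1 : ℝ) < x := hvl x hx
  have h2 : x ≤ M := polyTrace_subset_of_convex (convex_fst_le (M : ℝ))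
    (fun w hw => by simpa using hM w hw) hx
  exact_mod_cast h1.trans_le h2

/-! ### Mirror images -/

/-- The reflection that reverses the order of the columns. -/
def mirror (p : ℤ × ℝ) : ℤ × ℝ := (-p.1, p.2)

theorem mem_polyTrace_map_mirror (z : ℝ × ℝ) :
    ∀ l : List (ℤ × ℝ), z ∈ polyTrace (l.map mirror) ↔ (-z.1, z.2) ∈ polyTrace l
  | [] => by simp [polyTrace]
  | [p] => by simp [polyTrace, toPlane, mirror, Prod.ext_iff, neg_eq_iff_eq_neg]
  | p :: q :: l => by
    have h := mem_polyTrace_map_mirror z (q :: l)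
    simp only [List.map_cons, polyTrace, Set.mem_union] at h ⊢
    rw [h]
    refine or_congr_left ⟨?_, ?_⟩
    · rintro ⟨a, b, ha, hb, hab, rfl⟩
      exact ⟨a, b, ha, hb, hab, by simp [toPlane, mirror]; ring⟩
    · rintro ⟨a, b, ha, hb, hab, he⟩
      refine ⟨a, b, ha, hb, hab, ?_⟩
      simp only [toPlane, mirror, Prod.ext_iff, Prod.fst_add, Prod.smul_fst, Prod.snd_add,
        Prod.smul_snd, smul_eq_mul, Int.cast_neg] at he ⊢
      exact ⟨by linarith [he.1], he.2⟩

theorem dirLeftOf_mirror (o p q : ℤ × ℝ) :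
    DirLeftOf (toPlane (mirror q) - toPlane (mirror o)) (toPlane (mirror p) - toPlane (mirror o)) ↔
      DirLeftOf (toPlane p - toPlane o) (toPlane q - toPlane o) := by
  simp only [DirLeftOf, Prod.fst_sub, Prod.snd_sub, toPlane, mirror, Int.cast_neg]
  refine or_congr ?_ ⟨?_, ?_⟩
  · rw [← sub_pos, ← sub_pos (b := (0 : ℝ))]
    constructor <;> intro h <;> linarith
  · rintro ⟨h1, h2, h3, h4⟩
    exact ⟨by linarith, h4, by linarith, h2⟩
  · rintro ⟨h1, h2, h3, h4⟩
    exact ⟨by linarith, h4, by linarith, h2⟩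

theorem Descending.map_mirror {l : List (ℤ × ℝ)} (h : Descending l) :
    Descending (l.map mirror) :=
  List.pairwise_map.2 h

/-- The mirror image of `fst_lt_of_dirLeftOf`. -/
theorem lt_fst_of_dirLeftOf {o p q : ℤ × ℝ} {l m : List (ℤ × ℝ)}
    (hP : Descending (o :: p :: l)) (hQ : Descending (o :: q :: m))
    (hoP : toPlane o ∉ polyTrace (p :: l)) (hoQ : toPlane o ∉ polyTrace (q :: m))
    (hPQ : ∀ z ∈ polyTrace (o :: p :: l), z ∈ polyTrace (o :: q :: m) → z = toPlane o)
    (hdir : DirLeftOf (toPlane p - toPlane o) (toPlane q - toPlane o))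
    {b : ℤ × ℝ} (hb : b ∈ o :: p :: l) (hbQ : ∀ v ∈ q :: m, b.2 ≤ v.2)
    {M : ℤ} (hM : ∀ v ∈ o :: p :: l, M ≤ v.1) {v : ℤ × ℝ} (hv : v ∈ q :: m) : M < v.1 := by
  have ho : ∀ l, toPlane (mirror o) ∈ polyTrace (l.map mirror) ↔ toPlane o ∈ polyTrace l := by
    intro l
    rw [mem_polyTrace_map_mirror]
    simp [toPlane, mirror]
  have := fst_lt_of_dirLeftOf (o := mirror o) (p := mirror p) (q := mirror q) (l := l.map mirror)
    (m := m.map mirror) hP.map_mirror hQ.map_mirror (fun h => hoP ((ho (p :: l)).1 h))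
    (fun h => hoQ ((ho (q :: m)).1 h)) (fun z hz hz' => by
      have h := hPQ _ ((mem_polyTrace_map_mirror z (o :: p :: l)).1 hz)
        ((mem_polyTrace_map_mirror z (o :: q :: m)).1 hz')
      simp only [toPlane, mirror, Prod.ext_iff, Int.cast_neg] at h ⊢
      exact ⟨by linarith [h.1], h.2⟩) ((dirLeftOf_mirror o p q).2 hdir) (b := mirror b)
    (List.mem_map_of_mem hb) (by
      intro w hw
      obtain ⟨w', hw', rfl⟩ := List.mem_map.1 (show w ∈ (q :: m).map mirror from hw)
      exact hbQ w' hw') (M := -M) (by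
      intro w hw
      obtain ⟨w', hw', rfl⟩ := List.mem_map.1 (show w ∈ (o :: p :: l).map mirror from hw)
      simpa [mirror] using hM w' hw') (v := mirror v) (List.mem_map_of_mem hv)
  simpa [mirror] using this

/-! ### Subtrees and paths from the root -/

namespace PlaneTree

theorem Node.sub_injective {d : ℕ} {c : Fin d → PlaneTree} {i : Fin d} :
    Function.Injective (Node.sub (c := c) i) := by
  intro u v h
  cases h
  rfl

instance finite_node : ∀ T : PlaneTree, Finite T.Node
  | node d c => by
    have := fun i => finite_node (c i)
    refine Finite.of_surjective
      (fun x : Option (Σ i, Node (c i)) => x.elim (.root _) fun y => .sub y.1 y.2) ?_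
    rintro (_ | ⟨i, u⟩)
    · exact ⟨none, rfl⟩
    · exact ⟨some ⟨i, u⟩, rfl⟩

instance (T : PlaneTree) : Nonempty T.Node := ⟨.root T⟩

section

variable {d : ℕ} {c : Fin d → PlaneTree}

/-- The edge from the root to its `i`-th child. -/
def Edge.top (i : Fin d) : Edge (node d c) := ⟨.root _, i⟩

/-- An edge of the subtree at the `i`-th child, as an edge of the whole tree. -/
def Edge.sub (i : Fin d) (e : Edge (c i)) : Edge (node d c) := ⟨.sub i e.1, e.2⟩

theorem Edge.eq_top_or_eq_sub (e : Edge (node d c)) :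
    (∃ i, e = Edge.top i) ∨ ∃ i e', e = Edge.sub i e' := by
  obtain ⟨_ | ⟨i, u⟩, k⟩ := e
  · exact Or.inl ⟨k, rfl⟩
  · exact Or.inr ⟨i, ⟨u, k⟩, rfl⟩

theorem Edge.sub_injective {i : Fin d} : Function.Injective (Edge.sub (c := c) i) := by
  rintro ⟨u, k⟩ ⟨v, l⟩ h
  obtain ⟨h1, h2⟩ := Sigma.mk.inj_iff.1 h
  obtain rfl := Node.sub_injective h1
  obtain rfl := eq_of_heq h2
  rfl

theorem Edge.incident_top_iff {i : Fin d} {w : Node (node d c)} :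
    (Edge.top i : Edge (node d c)).Incident w ↔ w = .root _ ∨ w = .sub i (.root _) := Iff.rfl

theorem Edge.incident_sub_iff {i : Fin d} {e : Edge (c i)} {w : Node (node d c)} :
    (Edge.sub i e).Incident w ↔ ∃ u, e.Incident u ∧ w = .sub i u := by
  constructor
  · rintro (h | h)
    · exact ⟨_, Or.inl rfl, h⟩
    · exact ⟨_, Or.inr rfl, h⟩
  · rintro ⟨u, rfl | rfl, rfl⟩
    · exact Or.inl rfl
    · exact Or.inr rfl

end

end PlaneTree

theorem Descending.append {l₁ l₂ : List (ℤ × ℝ)} {p : ℤ × ℝ} (h₁ : Descending (l₁ ++ [p]))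
    (h₂ : Descending (p :: l₂)) : Descending (l₁ ++ p :: l₂) := by
  obtain ⟨h3, -, h4⟩ := List.pairwise_append.1 h₁
  refine List.pairwise_append.2 ⟨h3, h₂, fun a ha b hb => ?_⟩
  have hap := h4 a ha p (by simp)
  rcases List.mem_cons.1 hb with rfl | hb
  · exact hap
  · exact ((List.pairwise_cons.1 h₂).1 b hb).trans hap

theorem SimplePoly.toPlane_notMem {p : ℤ × ℝ} {l : List (ℤ × ℝ)} (h : SimplePoly (p :: l)) :
    toPlane p ∉ polyTrace l := by
  cases l with
  | nil => simp [polyTrace]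
  | cons q l =>
    intro hp
    exact h.1 (toPlane_injective (h.2.1 ⟨left_mem_segment ℝ _ _, hp⟩))

namespace PolyDrawing

open PlaneTree

section

variable {d : ℕ} {c : Fin d → PlaneTree}

/-- The drawing of the subtree at the `i`-th child of the root that is part of a drawing. -/
def restrict (D : PolyDrawing (node d c)) (i : Fin d) : PolyDrawing (c i) where
  pos u := D.pos (.sub i u)
  bends e := D.bends (Edge.sub i e)

theorem IsPlanar.restrict {D : PolyDrawing (node d c)} (h : D.IsPlanar) (i : Fin d) :
    (D.restrict i).IsPlanar := by
  obtain ⟨h1, h2, h3, h4⟩ := h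
  refine ⟨fun u v huv => Node.sub_injective (h1 huv), fun e => h2 (Edge.sub i e), ?_, ?_⟩
  · intro e w hw
    obtain ⟨u, hu, he⟩ := Edge.incident_sub_iff.1 (h3 (Edge.sub i e) (.sub i w) hw)
    rwa [Node.sub_injective he]
  · intro e f hef x hx
    obtain ⟨w, he, hf, rfl⟩ := h4 _ _ (Edge.sub_injective.ne hef) x hx
    obtain ⟨u, hu, rfl⟩ := Edge.incident_sub_iff.1 he
    obtain ⟨v, hv, huv⟩ := Edge.incident_sub_iff.1 hf
    obtain rfl := Node.sub_injective huv
    exact ⟨u, hu, hv, rfl⟩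

theorem IsUpward.restrict {D : PolyDrawing (node d c)} (h : D.IsUpward) (i : Fin d) :
    (D.restrict i).IsUpward := fun e => h (Edge.sub i e)

theorem IsOrderPreserving.restrict {D : PolyDrawing (node d c)} (h : D.IsOrderPreserving)
    (i : Fin d) : (D.restrict i).IsOrderPreserving := fun u => h (.sub i u)

end

/-- The vertices, from top to bottom, of the poly-line that represents the path from the root to
a node. -/
def rootPath : {T : PlaneTree} → PolyDrawing T → Node T → List (ℤ × ℝ)
  | node _ _, D, .root _ => [D.pos (.root _)]
  | node _ _, D, .sub i u => D.pos (.root _) :: (D.bends (Edge.top i) ++ (D.restrict i).rootPath u)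

theorem exists_rootPath_eq_cons {T : PlaneTree} (D : PolyDrawing T) (u : T.Node) :
    ∃ l, D.rootPath u = D.pos (.root T) :: l := by
  cases u with
  | root => cases T; exact ⟨[], rfl⟩
  | sub i u => exact ⟨_, rfl⟩

theorem exists_rootPath_eq_append {T : PlaneTree} (D : PolyDrawing T) (u : T.Node) :
    ∃ l, D.rootPath u = l ++ [D.pos u] := by
  induction u with
  | root T => cases T; exact ⟨[], rfl⟩
  | sub i u ih =>
    obtain ⟨l, hl⟩ := ih (D.restrict i)
    exact ⟨D.pos (.root _) :: (D.bends (Edge.top i) ++ l), by simp [rootPath, hl]; rfl⟩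

theorem pos_mem_rootPath {T : PlaneTree} (D : PolyDrawing T) (u : T.Node) :
    D.pos u ∈ D.rootPath u := by
  obtain ⟨l, hl⟩ := D.exists_rootPath_eq_append u
  simp [hl]

theorem bends_subset_rootPath {T : PlaneTree} (D : PolyDrawing T) (e : T.Edge) :
    D.bends e ⊆ D.rootPath e.child := by
  obtain ⟨u, k⟩ := e
  induction u with
  | root T =>
    cases T
    exact fun p hp => List.mem_cons_of_mem _ (List.mem_append_left _ hp)
  | sub i u ih =>
    exact fun p hp => List.mem_cons_of_mem _ (List.mem_append_right _ (ih (D.restrict i) k hp))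

theorem IsUpward.descending_rootPath {T : PlaneTree} {D : PolyDrawing T} (h : D.IsUpward)
    (u : T.Node) : Descending (D.rootPath u) := by
  induction u with
  | root T => cases T; exact List.pairwise_singleton _ _
  | sub i u ih =>
    have h1 := ih (h.restrict i)
    obtain ⟨l, hl⟩ := (D.restrict i).exists_rootPath_eq_cons u
    rw [hl] at h1
    simp only [rootPath, hl]
    exact Descending.append (l₁ := D.pos (.root _) :: D.bends (Edge.top i)) (h (Edge.top i)) h1

theorem IsUpward.snd_pos_le {T : PlaneTree} {D : PolyDrawing T} (h : D.IsUpward) {u : T.Node}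
    {p : ℤ × ℝ} (hp : p ∈ D.rootPath u) : (D.pos u).2 ≤ p.2 := by
  have h1 := h.descending_rootPath u
  obtain ⟨l, hl⟩ := D.exists_rootPath_eq_append u
  rw [hl] at h1 hp
  rcases List.mem_append.1 hp with hp | hp
  · exact (List.pairwise_append.1 h1).2.2 p hp _ (by simp)
  · rw [List.mem_singleton.1 hp]

theorem polyTrace_rootPath_sub {d : ℕ} {c : Fin d → PlaneTree} (D : PolyDrawing (node d c))
    (i : Fin d) (u : Node (c i)) :
    polyTrace (D.rootPath (.sub i u)) =
      D.curve (Edge.top i) ∪ polyTrace ((D.restrict i).rootPath u) := by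
  obtain ⟨l, hl⟩ := (D.restrict i).exists_rootPath_eq_cons u
  simp only [rootPath, hl]
  exact polyTrace_append _ _ (D.pos (.root _) :: D.bends (Edge.top i))

theorem polyTrace_rootPath_subset {T : PlaneTree} (D : PolyDrawing T) (u : T.Node) :
    polyTrace (D.rootPath u) ⊆ {toPlane (D.pos (.root T))} ∪ ⋃ e, D.curve e := by
  induction u with
  | root T => cases T; exact Set.subset_union_left
  | @sub d c i u ih =>
    rw [polyTrace_rootPath_sub]
    refine Set.union_subset
      (fun z hz => Or.inr (Set.mem_iUnion.2 ⟨Edge.top i, hz⟩)) fun z hz => ?_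
    rcases ih (D.restrict i) hz with hz | hz
    · refine Or.inr (Set.mem_iUnion.2 ⟨Edge.top i, ?_⟩)
      rw [hz]
      exact toPlane_mem_polyTrace (List.mem_cons_of_mem _ (List.mem_append_right _ (List.mem_singleton_self _)))
    · obtain ⟨e, he⟩ := Set.mem_iUnion.1 hz
      exact Or.inr (Set.mem_iUnion.2 ⟨Edge.sub i e, he⟩)

/-! ### Two branches at the root -/

section

variable {d : ℕ} {c : Fin d → PlaneTree}

/-- The vertices of the path from the root to a node below its `i`-th child, without the root. -/
def branchPath (D : PolyDrawing (node d c)) (i : Fin d) (u : Node (c i)) : List (ℤ × ℝ) :=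
  D.bends (Edge.top i) ++ (D.restrict i).rootPath u

theorem rootPath_sub (D : PolyDrawing (node d c)) (i : Fin d) (u : Node (c i)) :
    D.rootPath (.sub i u) = D.pos (.root _) :: D.branchPath i u := rfl

theorem exists_branchPath_eq_cons (D : PolyDrawing (node d c)) (i : Fin d) (u : Node (c i)) :
    ∃ l, D.branchPath i u = D.second (Edge.top i) :: l := by
  obtain ⟨l, hl⟩ := (D.restrict i).exists_rootPath_eq_cons u
  have key : ∀ (m : List (ℤ × ℝ)) (p : ℤ × ℝ), ∃ l', m ++ p :: l = (m ++ [p]).head (by simp) :: l'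
    | [], _ => ⟨l, rfl⟩
    | _ :: _, _ => ⟨_, rfl⟩
  rw [branchPath, hl]
  exact key (D.bends (Edge.top i)) _

/-- A point on the path to a node below the `i`-th child lies on an edge all whose ends are the
root or below the `i`-th child. -/
theorem exists_edge_of_mem_rootPath_sub {D : PolyDrawing (node d c)} {i : Fin d} {u : Node (c i)}
    {z : ℝ × ℝ} (hz : z ∈ polyTrace (D.rootPath (.sub i u))) :
    ∃ e : Edge (node d c), z ∈ D.curve e ∧ (e = Edge.top i ∨ ∃ e', e = Edge.sub i e') := by
  rw [polyTrace_rootPath_sub] at hz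
  rcases hz with hz | hz
  · exact ⟨_, hz, Or.inl rfl⟩
  · rcases polyTrace_rootPath_subset _ _ hz with hz | hz
    · refine ⟨Edge.top i, ?_, Or.inl rfl⟩
      rw [hz]
      exact toPlane_mem_polyTrace (List.mem_cons_of_mem _ (List.mem_append_right _ (List.mem_singleton_self _)))
    · obtain ⟨e, he⟩ := Set.mem_iUnion.1 hz
      exact ⟨Edge.sub i e, he, Or.inr ⟨e, rfl⟩⟩

theorem IsPlanar.root_notMem_branchPath {D : PolyDrawing (node d c)} (h : D.IsPlanar) (i : Fin d)
    (u : Node (c i)) : toPlane (D.pos (.root _)) ∉ polyTrace (D.branchPath i u) := by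
  obtain ⟨l, hl⟩ := (D.restrict i).exists_rootPath_eq_cons u
  intro hz
  rw [branchPath, hl, polyTrace_append, ← hl] at hz
  rcases hz with hz | hz
  · exact (h.2.1 (Edge.top i)).toPlane_notMem hz
  · rcases polyTrace_rootPath_subset _ _ hz with hz | hz
    · exact Node.noConfusion rfl (heq_of_eq (h.1 (toPlane_injective hz)))
    · obtain ⟨e, he⟩ := Set.mem_iUnion.1 hz
      obtain ⟨v, -, hv⟩ := Edge.incident_sub_iff.1 (h.2.2.1 (Edge.sub i e) (.root _) he)
      cases hv

theorem IsPlanar.eq_root_of_mem_rootPaths {D : PolyDrawing (node d c)} (h : D.IsPlanar)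
    {i j : Fin d} (hij : i ≠ j) {u : Node (c i)} {v : Node (c j)} {z : ℝ × ℝ}
    (hu : z ∈ polyTrace (D.rootPath (.sub i u))) (hv : z ∈ polyTrace (D.rootPath (.sub j v))) :
    z = toPlane (D.pos (.root _)) := by
  have key : ∀ {i : Fin d} {e : Edge (node d c)} {w : Node (node d c)},
      (e = Edge.top i ∨ ∃ e', e = Edge.sub i e') → e.Incident w →
        w = .root _ ∨ ∃ u, w = .sub i u := by
    rintro i e w (rfl | ⟨e', rfl⟩) hw
    · exact (Edge.incident_top_iff.1 hw).imp_right fun h => ⟨_, h⟩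
    · obtain ⟨u, -, hu⟩ := Edge.incident_sub_iff.1 hw
      exact Or.inr ⟨u, hu⟩
  obtain ⟨e, hze, he⟩ := exists_edge_of_mem_rootPath_sub hu
  obtain ⟨f, hzf, hf⟩ := exists_edge_of_mem_rootPath_sub hv
  have hef : e ≠ f := by
    rintro rfl
    have hc : e.Incident e.child := Or.inr rfl
    rcases he with rfl | ⟨e', rfl⟩ <;> rcases hf with hf | ⟨f', hf⟩ <;>
      (have h1 := congrArg Edge.child hf
       injection h1 with h1 h2 h3
       exact hij (by assumption))
  obtain ⟨w, hwe, hwf, rfl⟩ := h.2.2.2 e f hef z ⟨hze, hzf⟩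
  rcases key he hwe with rfl | ⟨u', rfl⟩
  · rfl
  · rcases key hf hwf with hw | ⟨v', hw⟩
    · rw [hw]
    · injection hw with h1 h2
      exact absurd (by assumption) hij

/-- If the path to `v`, in a branch to the right of the one that contains `u`, descends at least as
far as `u`, then it has the path to `u` on its left, and the latter avoids its last column. -/
theorem IsPlanar.fst_lt {D : PolyDrawing (node d c)} (hD : D.IsPlanar) (hU : D.IsUpward)
    (hO : D.IsOrderPreserving) {i j : Fin d} (hij : i < j) {u : Node (c i)} {v : Node (c j)}
    (hvu : (D.pos (.sub j v)).2 ≤ (D.pos (.sub i u)).2) {M : ℤ}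
    (hM : ∀ p ∈ D.rootPath (.sub j v), p.1 ≤ M) {p : ℤ × ℝ} (hp : p ∈ D.branchPath i u) :
    p.1 < M := by
  obtain ⟨l, hl⟩ := D.exists_branchPath_eq_cons i u
  obtain ⟨m, hm⟩ := D.exists_branchPath_eq_cons j v
  have hP := hU.descending_rootPath (.sub j v)
  have hQ := hU.descending_rootPath (.sub i u)
  have hoP := hD.root_notMem_branchPath j v
  have hoQ := hD.root_notMem_branchPath i u
  have hPQ := fun z hz hz' => hD.eq_root_of_mem_rootPaths (z := z) hij.ne' (u := v) (v := u) hz hz'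
  have hb := D.pos_mem_rootPath (.sub j v)
  have hbQ : ∀ q ∈ D.branchPath i u, (D.pos (.sub j v)).2 ≤ q.2 := fun q hq =>
    hvu.trans (hU.snd_pos_le (u := .sub i u) (List.mem_cons_of_mem _ hq))
  simp only [rootPath_sub, hl, hm] at hP hQ hoP hoQ hPQ hb hbQ hM hp
  exact fst_lt_of_dirLeftOf hP hQ hoP hoQ hPQ (hO (.root _) i j hij) hb hbQ hM hp

/-- The mirror image of `IsPlanar.fst_lt`. -/
theorem IsPlanar.lt_fst {D : PolyDrawing (node d c)} (hD : D.IsPlanar) (hU : D.IsUpward)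
    (hO : D.IsOrderPreserving) {i j : Fin d} (hij : i < j) {u : Node (c i)} {v : Node (c j)}
    (huv : (D.pos (.sub i u)).2 ≤ (D.pos (.sub j v)).2) {M : ℤ}
    (hM : ∀ p ∈ D.rootPath (.sub i u), M ≤ p.1) {p : ℤ × ℝ} (hp : p ∈ D.branchPath j v) :
    M < p.1 := by
  obtain ⟨l, hl⟩ := D.exists_branchPath_eq_cons j v
  obtain ⟨m, hm⟩ := D.exists_branchPath_eq_cons i u
  have hP := hU.descending_rootPath (.sub i u)
  have hQ := hU.descending_rootPath (.sub j v)
  have hoP := hD.root_notMem_branchPath i u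
  have hoQ := hD.root_notMem_branchPath j v
  have hPQ := fun z hz hz' => hD.eq_root_of_mem_rootPaths (z := z) hij.ne (u := u) (v := v) hz hz'
  have hb := D.pos_mem_rootPath (.sub i u)
  have hbQ : ∀ q ∈ D.branchPath j v, (D.pos (.sub i u)).2 ≤ q.2 := fun q hq =>
    huv.trans (hU.snd_pos_le (u := .sub j v) (List.mem_cons_of_mem _ hq))
  simp only [rootPath_sub, hl, hm] at hP hQ hoP hoQ hPQ hb hbQ hM hp
  exact lt_fst_of_dirLeftOf hP hQ hoP hoQ hPQ (hO (.root _) i j hij) hb hbQ hM hp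

end

/-! ### Lower bounds for order-preserving drawings -/

/-- All nodes and bends lie in the columns `a, …, b`. -/
def InColumns {T : PlaneTree} (D : PolyDrawing T) (a b : ℤ) : Prop :=
  (∀ u, a ≤ (D.pos u).1 ∧ (D.pos u).1 ≤ b) ∧ ∀ e, ∀ p ∈ D.bends e, a ≤ p.1 ∧ p.1 ≤ b

theorem InColumns.restrict {d : ℕ} {c : Fin d → PlaneTree} {D : PolyDrawing (node d c)} {a b : ℤ}
    (h : D.InColumns a b) (i : Fin d) : (D.restrict i).InColumns a b :=
  ⟨fun u => h.1 (.sub i u), fun e => h.2 (Edge.sub i e)⟩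

theorem InColumns.of_mem_rootPath {T : PlaneTree} {D : PolyDrawing T} {a b : ℤ}
    (h : D.InColumns a b) {u : T.Node} {p : ℤ × ℝ} (hp : p ∈ D.rootPath u) :
    a ≤ p.1 ∧ p.1 ≤ b := by
  induction u with
  | root T =>
    cases T
    rw [List.mem_singleton.1 hp]
    exact h.1 _
  | sub i u ih =>
    rcases List.mem_cons.1 hp with rfl | hp
    · exact h.1 _
    · rcases List.mem_append.1 hp with hp | hp
      · exact h.2 _ p hp
      · exact ih (h.restrict i) hp

theorem inColumns_restrict {d : ℕ} {c : Fin d → PlaneTree} {D : PolyDrawing (node d c)} {a b : ℤ}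
    {i : Fin d} (h : ∀ u, ∀ p ∈ D.branchPath i u, a ≤ p.1 ∧ p.1 ≤ b) :
    (D.restrict i).InColumns a b :=
  ⟨fun u => h u _ (List.mem_append_right _ (pos_mem_rootPath _ u)),
    fun e p hp => h e.child p (List.mem_append_right _ (bends_subset_rootPath _ e hp))⟩

end PolyDrawing

namespace PlaneTree

open PolyDrawing

/-- Every planar order-preserving upward drawing of `T` uses at least `n` columns. -/
def NeedsColumns (T : PlaneTree) (n : ℕ) : Prop :=
  ∀ D : PolyDrawing T, D.IsPlanar → D.IsUpward → D.IsOrderPreserving →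
    ∀ a b : ℤ, D.InColumns a b → (n : ℤ) ≤ b - a + 1

theorem needsColumns_one (T : PlaneTree) : T.NeedsColumns 1 := by
  intro D _ _ _ a b h
  have := h.1 (.root T)
  push_cast
  omega

section

variable {d : ℕ} {c : Fin d → PlaneTree} {D : PolyDrawing (node d c)} {a b : ℤ}

/-- If the branch of `j` descends at least as far as the branch of `i`, then a path to its lowest
node passes beside the subtree at `i` and deprives it of one column. -/
theorem NeedsColumns.of_lower_branch (hD : D.IsPlanar) (hU : D.IsUpward)
    (hO : D.IsOrderPreserving) (h : D.InColumns a b) {i j : Fin d} (hij : i ≠ j)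
    {v : Node (c j)} (hv : ∀ u : Node (c i), (D.pos (.sub j v)).2 ≤ (D.pos (.sub i u)).2)
    {n : ℕ} (hn : (c i).NeedsColumns n) : (n : ℤ) ≤ b - a := by
  have hr := hn _ (hD.restrict i) (hU.restrict i) (hO.restrict i)
  have hin := fun u p (hp : p ∈ D.branchPath i u) =>
    h.of_mem_rootPath (u := .sub i u) (List.mem_cons_of_mem _ hp)
  rcases lt_or_gt_of_ne hij with hij | hij
  · have := hr a (b - 1) (inColumns_restrict fun u p hp => ⟨(hin u p hp).1, by
      have := hD.fst_lt hU hO hij (hv u) (fun q hq => (h.of_mem_rootPath hq).2) hp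
      omega⟩)
    omega
  · have := hr (a + 1) b (inColumns_restrict fun u p hp => ⟨by
      have := hD.lt_fst hU hO hij (hv u) (fun q hq => (h.of_mem_rootPath hq).1) hp
      omega, (hin u p hp).2⟩)
    omega

/-- The case of `needsColumns_of_five` in which the root is not in the last column; `i < j` are two
children to the left of `s`. -/
theorem NeedsColumns.of_two_left (hD : D.IsPlanar) (hU : D.IsUpward)
    (hO : D.IsOrderPreserving) (h : D.InColumns a b) {i j s : Fin d} (hij : i < j) (hjs : j < s)
    (hroot : (D.pos (.root _)).1 < b) {w : Node (c s)}
    (hwj : ∀ u : Node (c j), (D.pos (.sub s w)).2 ≤ (D.pos (.sub j u)).2)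
    {n : ℕ} (hi : (c i).NeedsColumns n) (hj : (c j).NeedsColumns n) : (n : ℤ) + 1 ≤ b - a := by
  have hlt : ∀ v, ∀ p ∈ D.branchPath j v, p.1 < b := fun v p hp =>
    hD.fst_lt hU hO hjs (hwj v) (fun q hq => (h.of_mem_rootPath hq).2) hp
  have hge : ∀ k u, ∀ p ∈ D.branchPath k u, a ≤ p.1 := fun k u p hp =>
    (h.of_mem_rootPath (u := .sub k u) (List.mem_cons_of_mem _ hp)).1
  obtain ⟨u₀, hu₀⟩ := Finite.exists_min fun u : Node (c i) => (D.pos (.sub i u)).2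
  obtain ⟨v₀, hv₀⟩ := Finite.exists_min fun v : Node (c j) => (D.pos (.sub j v)).2
  rcases le_total (D.pos (.sub j v₀)).2 (D.pos (.sub i u₀)).2 with hle | hle
  · -- the subtree at `i` loses the last two columns
    have hM : ∀ p ∈ D.rootPath (.sub j v₀), p.1 ≤ b - 1 := by
      intro p hp
      rcases List.mem_cons.1 hp with rfl | hp
      · omega
      · have := hlt v₀ p hp
        omega
    have := hi _ (hD.restrict i) (hU.restrict i) (hO.restrict i) a (b - 2)
      (inColumns_restrict fun u p hp => ⟨hge i u p hp, by
        have := hD.fst_lt hU hO hij (hle.trans (hu₀ u)) hM hp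
        omega⟩)
    omega
  · -- the subtree at `j` loses the first and the last column
    have := hj _ (hD.restrict j) (hU.restrict j) (hO.restrict j) (a + 1) (b - 1)
      (inColumns_restrict fun v p hp => ⟨by
        have := hD.lt_fst hU hO hij (hle.trans (hv₀ v))
          (fun q hq => (h.of_mem_rootPath hq).1) hp
        omega, by
        have := hlt v p hp
        omega⟩)
    omega

/-- The mirror image of `NeedsColumns.of_two_left`. -/
theorem NeedsColumns.of_two_right (hD : D.IsPlanar) (hU : D.IsUpward)
    (hO : D.IsOrderPreserving) (h : D.InColumns a b) {i j s : Fin d} (hsi : s < i) (hij : i < j)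
    (hroot : a < (D.pos (.root _)).1) {w : Node (c s)}
    (hwi : ∀ u : Node (c i), (D.pos (.sub s w)).2 ≤ (D.pos (.sub i u)).2)
    {n : ℕ} (hi : (c i).NeedsColumns n) (hj : (c j).NeedsColumns n) : (n : ℤ) + 1 ≤ b - a := by
  have hlt : ∀ u, ∀ p ∈ D.branchPath i u, a < p.1 := fun u p hp =>
    hD.lt_fst hU hO hsi (hwi u) (fun q hq => (h.of_mem_rootPath hq).1) hp
  have hge : ∀ k u, ∀ p ∈ D.branchPath k u, p.1 ≤ b := fun k u p hp =>
    (h.of_mem_rootPath (u := .sub k u) (List.mem_cons_of_mem _ hp)).2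
  obtain ⟨u₀, hu₀⟩ := Finite.exists_min fun u : Node (c i) => (D.pos (.sub i u)).2
  obtain ⟨v₀, hv₀⟩ := Finite.exists_min fun v : Node (c j) => (D.pos (.sub j v)).2
  rcases le_total (D.pos (.sub j v₀)).2 (D.pos (.sub i u₀)).2 with hle | hle
  · -- the subtree at `i` loses the first and the last column
    have := hi _ (hD.restrict i) (hU.restrict i) (hO.restrict i) (a + 1) (b - 1)
      (inColumns_restrict fun u p hp => ⟨by
        have := hlt u p hp
        omega, by
        have := hD.fst_lt hU hO hij (hle.trans (hu₀ u))
          (fun q hq => (h.of_mem_rootPath hq).2) hp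
        omega⟩)
    omega
  · -- the subtree at `j` loses the first two columns
    have hM : ∀ p ∈ D.rootPath (.sub i u₀), a + 1 ≤ p.1 := by
      intro p hp
      rcases List.mem_cons.1 hp with rfl | hp
      · omega
      · have := hlt u₀ p hp
        omega
    have := hj _ (hD.restrict j) (hU.restrict j) (hO.restrict j) (a + 2) b
      (inColumns_restrict fun v p hp => ⟨by
        have := hD.lt_fst hU hO hij (hle.trans (hv₀ v)) hM hp
        omega, hge j v p hp⟩)
    omega

end

theorem needsColumns_of_two {d : ℕ} {c : Fin d → PlaneTree} {i j : Fin d} (hij : i ≠ j) {n : ℕ}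
    (hi : (c i).NeedsColumns n) (hj : (c j).NeedsColumns n) :
    (node d c).NeedsColumns (n + 1) := by
  intro D hD hU hO a b h
  obtain ⟨u₀, hu₀⟩ := Finite.exists_min fun u : Node (c i) => (D.pos (.sub i u)).2
  obtain ⟨v₀, hv₀⟩ := Finite.exists_min fun v : Node (c j) => (D.pos (.sub j v)).2
  push_cast
  rcases le_total (D.pos (.sub j v₀)).2 (D.pos (.sub i u₀)).2 with hle | hle
  · have := NeedsColumns.of_lower_branch hD hU hO h hij (fun u => hle.trans (hu₀ u)) hi
    omega
  · have := NeedsColumns.of_lower_branch hD hU hO h hij.symm (fun v => hle.trans (hv₀ v)) hj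
    omega

/-- If the middle one of five children needs one column more than the others, then either its
branch is not the lowest one and some path passes beside it, or a path to its lowest node separates
the branches on its left from those on its right. In the latter case the first two branches, if
the root is not in the last column, and otherwise the last two, share all but one column, and a
path through one of them costs the other one a further column. -/
theorem needsColumns_of_five {d : ℕ} {c : Fin d → PlaneTree} {i j s k l : Fin d} (hij : i < j)
    (hjs : j < s) (hsk : s < k) (hkl : k < l) {n : ℕ} (hn : 1 ≤ n) (hi : (c i).NeedsColumns n)
    (hj : (c j).NeedsColumns n) (hs : (c s).NeedsColumns (n + 1)) (hk : (c k).NeedsColumns n)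
    (hl : (c l).NeedsColumns n) : (node d c).NeedsColumns (n + 2) := by
  intro D hD hU hO a b h
  obtain ⟨w, hw⟩ := Finite.exists_min fun w : Node (c s) => (D.pos (.sub s w)).2
  push_cast
  by_contra! hcon
  have low : ∀ m ≠ s, ∀ u : Node (c m), (D.pos (.sub s w)).2 ≤ (D.pos (.sub m u)).2 := by
    intro m hm u
    by_contra! hlt
    have := NeedsColumns.of_lower_branch hD hU hO h hm.symm (fun v => hlt.le.trans (hw v)) hs
    push_cast at this
    omega
  have hb : ((n : ℕ) : ℤ) + 1 ≤ b - a + 1 := by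
    have := hs _ (hD.restrict s) (hU.restrict s) (hO.restrict s) a b (h.restrict s)
    push_cast at this
    omega
  by_cases hroot : (D.pos (.root _)).1 < b
  · have := NeedsColumns.of_two_left hD hU hO h hij hjs hroot (low j hjs.ne) hi hj
    omega
  · have := NeedsColumns.of_two_right hD hU hO h hsk hkl (by omega) (low k hsk.ne')
      hk hl
    omega

end PlaneTree

/-! ### Unordered drawings -/

namespace PolyDrawing

open PlaneTree

/-- A drawing is planar if the drawings of the subtrees at the children of the root are planar and
lie in disjoint regions `B j` that the edges at the root meet at most in their lower ends. -/
theorem isPlanar_of_restrict {d : ℕ} {c : Fin d → PlaneTree} {D : PolyDrawing (node d c)}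
    (h : ∀ j, (D.restrict j).IsPlanar) (B : Fin d → Set (ℝ × ℝ))
    (hcurve : ∀ j e, D.curve (Edge.sub j e) ⊆ B j)
    (hpos : ∀ j u, toPlane (D.pos (.sub j u)) ∈ B j)
    (hdisj : ∀ {i j x}, x ∈ B i → x ∈ B j → i = j)
    (hroot : ∀ j, toPlane (D.pos (.root _)) ∉ B j)
    (hsimple : ∀ j, SimplePoly (D.poly (Edge.top j)))
    (htop : ∀ {i j x}, x ∈ D.curve (Edge.top i) → x ∈ B j →
      x = toPlane (D.pos (.sub i (.root _))))
    (htop' : ∀ {i j x}, i ≠ j → x ∈ D.curve (Edge.top i) → x ∈ D.curve (Edge.top j) →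
      x = toPlane (D.pos (.root _))) : D.IsPlanar := by
  refine ⟨?_, ?_, ?_, ?_⟩
  · rintro (_ | ⟨i, u⟩) (_ | ⟨j, v⟩) huv
    · rfl
    · exact absurd (huv ▸ hpos j v) (hroot j)
    · exact absurd (huv ▸ hpos i u) (hroot i)
    · obtain rfl := hdisj (hpos i u) (huv ▸ hpos j v)
      exact congrArg _ ((h i).1 huv)
  · intro e
    rcases e.eq_top_or_eq_sub with ⟨i, rfl⟩ | ⟨i, e, rfl⟩
    · exact hsimple i
    · exact (h i).2.1 e
  · intro e w hw
    rcases e.eq_top_or_eq_sub with ⟨i, rfl⟩ | ⟨i, e, rfl⟩ <;> rcases w with _ | ⟨j, u⟩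
    · exact Or.inl rfl
    · have hx := htop hw (hpos j u)
      obtain rfl := hdisj (hpos j u) (hx ▸ hpos i _)
      obtain rfl := (h j).1 (toPlane_injective hx)
      exact Or.inr rfl
    · exact absurd (hcurve i e hw) (hroot i)
    · obtain rfl := hdisj (hpos j u) (hcurve i e hw)
      exact Edge.incident_sub_iff.2 ⟨u, (h j).2.2.1 e u hw, rfl⟩
  · -- an edge at the root and an edge of a subtree
    have key : ∀ {i j x} {e : Edge (c j)}, x ∈ D.curve (Edge.top i) → x ∈ D.curve (Edge.sub j e) →
        ∃ w, (Edge.top i : Edge (node d c)).Incident w ∧ (Edge.sub j e).Incident w ∧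
          x = toPlane (D.pos w) := by
      intro i j x e hi hj
      obtain rfl := htop hi (hcurve j e hj)
      obtain rfl := hdisj (hpos i _) (hcurve j e hj)
      exact ⟨_, Or.inr rfl, Edge.incident_sub_iff.2 ⟨_, (h i).2.2.1 e _ hj, rfl⟩, rfl⟩
    rintro e f hef x ⟨hxe, hxf⟩
    rcases e.eq_top_or_eq_sub with ⟨i, rfl⟩ | ⟨i, e, rfl⟩ <;>
      rcases f.eq_top_or_eq_sub with ⟨j, rfl⟩ | ⟨j, f, rfl⟩
    · exact ⟨.root _, Or.inl rfl, Or.inl rfl, htop' (fun hij => hef (congrArg _ hij)) hxe hxf⟩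
    · exact key hxe hxf
    · obtain ⟨w, h1, h2, h3⟩ := key hxf hxe
      exact ⟨w, h2, h1, h3⟩
    · obtain rfl := hdisj (hcurve i e hxe) (hcurve j f hxf)
      obtain ⟨w, h1, h2, h3⟩ := (h i).2.2.2 e f (fun h => hef (h ▸ rfl)) x ⟨hxe, hxf⟩
      exact ⟨_, Edge.incident_sub_iff.2 ⟨w, h1, rfl⟩, Edge.incident_sub_iff.2 ⟨w, h2, rfl⟩, h3⟩

/-- The straight-line drawing with given positions of the nodes. -/
def straight {T : PlaneTree} (p : T.Node → ℤ × ℝ) : PolyDrawing T where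
  pos := p
  bends _ := []

theorem curve_straight {T : PlaneTree} (p : T.Node → ℤ × ℝ) (e : T.Edge) :
    (straight p).curve e = segment ℝ (toPlane (p e.parent)) (toPlane (p e.child)) := by
  change segment ℝ _ _ ∪ {_} = _
  exact Set.union_eq_left.2 (Set.singleton_subset_iff.2 (right_mem_segment ℝ _ _))

theorem simplePoly_pair {p q : ℤ × ℝ} (h : p ≠ q) : SimplePoly [p, q] :=
  ⟨h, Set.inter_subset_right, trivial⟩

theorem toPlane_add (p q : ℤ × ℝ) : toPlane (p + q) = toPlane p + toPlane q := by
  simp [toPlane]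

theorem toPlane_zero : toPlane 0 = 0 := by
  simp [toPlane]

theorem IsPlanar.straight_translate {T : PlaneTree} {p : T.Node → ℤ × ℝ}
    (h : (straight p).IsPlanar) (o : ℤ × ℝ) : (straight fun u => o + p u).IsPlanar := by
  have hc : ∀ e x, x ∈ (straight fun u => o + p u).curve e ↔
      x - toPlane o ∈ (straight p).curve e := by
    intro e x
    rw [curve_straight, curve_straight, toPlane_add, toPlane_add,
      ← mem_segment_translate ℝ (toPlane o) (x := x - toPlane o), add_sub_cancel]
  have hx : ∀ u x, x = toPlane (o + p u) ↔ x - toPlane o = toPlane (p u) := by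
    intro u x
    rw [toPlane_add, sub_eq_iff_eq_add']
  refine ⟨fun u v huv => h.1 (add_left_cancel huv), fun e => simplePoly_pair fun he => ?_,
    fun e w hw => h.2.2.1 e w ?_, ?_⟩
  · exact (h.2.1 e).1 (add_left_cancel he)
  · have h1 := (hc e _).1 hw
    change toPlane (o + p w) - toPlane o ∈ _ at h1
    rwa [(hx w (toPlane (o + p w))).1 rfl] at h1
  · rintro e f hef x ⟨hxe, hxf⟩
    obtain ⟨w, h1, h2, h3⟩ := h.2.2.2 e f hef _ ⟨(hc e x).1 hxe, (hc f x).1 hxf⟩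
    exact ⟨w, h1, h2, (hx w x).2 h3⟩

/-- Positions of the nodes of a tree: the root is at the origin, and the subtree at the `j`-th
child is translated by `o j`. -/
def gluePos {d : ℕ} {c : Fin d → PlaneTree} (p : ∀ j, Node (c j) → ℤ × ℝ) (o : Fin d → ℤ × ℝ) :
    Node (node d c) → ℤ × ℝ
  | .root _ => 0
  | .sub j u => o j + p j u

/-- The subtrees at the children of the root are drawn one below the other, the one at `h` last
and directly below the root, the others from one column further right on. -/
theorem isPlanar_straight_gluePos {d : ℕ} {c : Fin d → PlaneTree} {p : ∀ j, Node (c j) → ℤ × ℝ}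
    (hp : ∀ j, (straight (p j)).IsPlanar) (hroot : ∀ j, p j (.root _) = 0)
    (hx : ∀ j u, 0 ≤ (p j u).1) (hy : ∀ j u, (p j u).2 ≤ 0) {H : ℝ} (hH : 0 < H)
    (hyH : ∀ j u, -H < (p j u).2) {o : Fin d → ℤ × ℝ} {h : Fin d}
    (hox : ∀ j, (o j).1 = if j = h then 0 else 1)
    (hoy : ∀ j, (o j).2 = -(1 + ((if j = h then d else j : ℕ) : ℝ) * H)) :
    (straight (gluePos p o)).IsPlanar := by
  have hneg : ∀ j, (o j).2 < 0 := by
    intro j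
    rw [hoy]
    have := mul_nonneg (Nat.cast_nonneg (α := ℝ) (if j = h then d else (j : ℕ))) hH.le
    linarith
  -- the subtrees occupy horizontal strips of height `H`
  have hstep : ∀ i j : Fin d, i ≠ j →
      (o i).2 ≤ (o j).2 - H ∨ (i ≠ h ∧ (o j).2 ≤ (o i).2 - H) := by
    intro i j hij
    have hval : ∀ a b : ℕ, a < b → -(1 + (b : ℝ) * H) ≤ -(1 + (a : ℝ) * H) - H := by
      intro a b hab
      have : (a : ℝ) + 1 ≤ b := by exact_mod_cast hab
      nlinarith
    rw [hoy, hoy]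
    by_cases hih : i = h
    · left
      rw [if_pos hih, if_neg fun hj => hij (hih.trans hj.symm)]
      exact hval _ _ j.2
    · by_cases hjh : j = h
      · right
        rw [if_neg hih, if_pos hjh]
        exact ⟨hih, hval _ _ i.2⟩
      · rw [if_neg hih, if_neg hjh]
        rcases lt_or_gt_of_ne hij with hlt | hlt
        · exact Or.inr ⟨hih, hval _ _ hlt⟩
        · exact Or.inl (hval _ _ hlt)
  have hstep_h : ∀ i, i ≠ h → (o h).2 ≤ (o i).2 - H := by
    intro i hi
    rcases hstep h i hi.symm with h1 | h1
    · exact h1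
    · exact absurd rfl h1.1
  have htopc : ∀ {i x}, x ∈ (straight (gluePos p o)).curve (Edge.top i) →
      ∃ t : ℝ, 0 ≤ t ∧ t ≤ 1 ∧ x = t • toPlane (o i) := by
    intro i x hxi
    rw [curve_straight, segment_eq_image_lineMap] at hxi
    obtain ⟨t, ht, rfl⟩ := hxi
    refine ⟨t, ht.1, ht.2, ?_⟩
    simp only [Edge.top, Edge.parent, Edge.child, Node.child, gluePos, hroot, add_zero,
      toPlane_zero, AffineMap.lineMap_apply, vsub_eq_sub, sub_zero, vadd_eq_add]
  have hhead : ∀ i, gluePos p o (.sub i (.root _)) = o i := by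
    intro i
    simp [gluePos, hroot]
  set B : Fin d → Set (ℝ × ℝ) := fun j =>
    {z | ((o j).1 : ℝ) ≤ z.1} ∩ ({z | z.2 ≤ (o j).2} ∩ {z | (o j).2 - H < z.2}) with hBdef
  have hB : ∀ j, Convex ℝ (B j) := fun j => (convex_le_fst _).inter ((convex_snd_le _).inter
    (convex_halfSpace_gt (LinearMap.snd ℝ ℝ ℝ).isLinear _))
  have hpos : ∀ j u, toPlane (gluePos p o (.sub j u)) ∈ B j := by
    intro j u
    refine ⟨?_, ?_, ?_⟩
    · simpa [gluePos] using hx j u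
    · simpa [gluePos] using hy j u
    · have := hyH j u
      simp only [gluePos, Set.mem_ofPred_eq, toPlane_snd, Prod.snd_add]
      linarith
  refine isPlanar_of_restrict (fun j => (hp j).straight_translate (o j)) B ?_ hpos ?_ ?_ ?_ ?_ ?_
  · intro j e
    rw [curve_straight]
    exact (hB j).segment_subset (hpos j e.parent) (hpos j e.child)
  · intro i j x hi hj
    by_contra hij
    rcases hstep i j hij with h1 | ⟨-, h1⟩
    · linarith [hi.2.1.out, hj.2.2.out]
    · linarith [hj.2.1.out, hi.2.2.out]
  · intro j h0
    have : (0 : ℝ) ≤ (o j).2 := h0.2.1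
    linarith [hneg j]
  · intro j
    refine simplePoly_pair ?_
    change 0 ≠ gluePos p o (.sub j (.root _))
    rw [hhead]
    intro h0
    have := hneg j
    rw [← h0] at this
    exact lt_irrefl _ this
  · intro i j x hxi hxj
    obtain ⟨t, ht0, ht1, rfl⟩ := htopc hxi
    have h1 : ((o j).1 : ℝ) ≤ t * (o i).1 := hxj.1
    have h2 : t * (o i).2 ≤ (o j).2 := hxj.2.1
    suffices ht : t = 1 by
      rw [ht, one_smul]
      exact congrArg toPlane (hhead i).symm
    rw [hox, hox] at h1
    have hni := hneg i
    by_cases hih : i = h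
    · by_cases hjh : j = h
      · rw [hih, hjh] at h2
        rw [hih] at hni
        nlinarith
      · simp only [hih, hjh, if_true, if_false, Int.cast_zero, Int.cast_one, mul_zero] at h1
        linarith
    · by_cases hjh : j = h
      · have := hstep_h i hih
        rw [hjh] at h2
        nlinarith
      · simp only [hih, hjh, if_false, Int.cast_one, mul_one] at h1
        linarith
  · intro i j x hij hxi hxj
    obtain ⟨t, ht0, ht1, rfl⟩ := htopc hxi
    obtain ⟨s, hs0, hs1, hst⟩ := htopc hxj
    change t • toPlane (o i) = toPlane 0
    rw [toPlane_zero]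
    have h1 : t * ((o i).1 : ℝ) = s * (o j).1 := congrArg Prod.fst hst
    have h2 : t * (o i).2 = s * (o j).2 := congrArg Prod.snd hst
    rw [hox, hox] at h1
    by_cases hih : i = h
    · have hjh : j ≠ h := fun hj => hij (hih.trans hj.symm)
      simp only [hih, hjh, if_true, if_false, Int.cast_zero, Int.cast_one, mul_zero,
        mul_one] at h1
      rw [hst, ← h1, zero_smul]
    · by_cases hjh : j = h
      · simp only [hih, hjh, if_true, if_false, Int.cast_zero, Int.cast_one, mul_zero,
          mul_one] at h1
        rw [h1, zero_smul]
      · simp only [hih, hjh, if_false, Int.cast_one, mul_one] at h1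
        have hne : (o i).2 - (o j).2 ≠ 0 := by
          rcases hstep i j hij with h3 | ⟨-, h3⟩
          · exact (by linarith : (o i).2 - (o j).2 < 0).ne
          · exact (by linarith : 0 < (o i).2 - (o j).2).ne'
        have h3 : t * ((o i).2 - (o j).2) = 0 := by
          rw [mul_sub, h2, h1, sub_self]
        rw [(mul_eq_zero.1 h3).resolve_right hne, zero_smul]

/-- The columns used are exactly `0, …, rpw T - 1`. -/
theorem exists_straight_drawing (T : PlaneTree) :
    ∃ p : T.Node → ℤ × ℝ, (straight p).IsPlanar ∧ (straight p).IsUpward ∧ p (.root T) = 0 ∧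
      (∀ u, (p u).2 ≤ 0) ∧ (∀ u, 0 ≤ (p u).1 ∧ (p u).1 + 1 ≤ T.rpw) ∧
      ∃ u, (p u).1 + 1 = T.rpw := by
  induction T with
  | node d c ih =>
  cases d with
  | zero =>
    refine ⟨fun _ => 0, ⟨?_, fun e => ?_, fun e => ?_, fun e => ?_⟩, fun e => ?_, rfl,
      fun _ => le_rfl, fun _ => ?_, ⟨.root _, ?_⟩⟩
    · rintro (_ | ⟨i, u⟩) (_ | ⟨j, v⟩) -
      · rfl
      · exact j.elim0
      · exact i.elim0
      · exact i.elim0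
    all_goals first
      | (rcases e.eq_top_or_eq_sub with ⟨i, -⟩ | ⟨i, -⟩ <;> exact i.elim0)
      | simp [rpw]
  | succ d =>
  choose p hp hup hroot hy hx hwit using ih
  obtain ⟨h, -, hh⟩ := Finset.exists_mem_eq_inf' (s := Finset.univ) Finset.univ_nonempty
    fun h : Fin (d + 1) => Finset.univ.sup fun i => rpw (c i) + if i = h then 0 else 1
  change rpw (node (d + 1) c) = _ at hh
  have hle : ∀ j, rpw (c j) + (if j = h then 0 else 1) ≤ rpw (node (d + 1) c) := fun j => by
    rw [hh]
    exact Finset.le_sup (f := fun i => rpw (c i) + if i = h then 0 else 1) (Finset.mem_univ j)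
  obtain ⟨m, -, hm⟩ := Finset.exists_mem_eq_sup (Finset.univ : Finset (Fin (d + 1)))
    Finset.univ_nonempty fun i => rpw (c i) + if i = h then 0 else 1
  rw [← hh] at hm
  -- a common bound for the heights of the drawings of the subtrees
  have : Nonempty (Σ j, Node (c j)) := ⟨⟨h, .root _⟩⟩
  obtain ⟨x₀, hx₀⟩ := Finite.exists_min fun x : Σ j, Node (c j) => (p x.1 x.2).2
  set H : ℝ := 1 - (p x₀.1 x₀.2).2 with hH
  have hHpos : 0 < H := by linarith [hy x₀.1 x₀.2]
  have hyH : ∀ j u, -H < (p j u).2 := fun j u => by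
    have : (p x₀.1 x₀.2).2 ≤ (p j u).2 := hx₀ ⟨j, u⟩
    linarith
  set o : Fin (d + 1) → ℤ × ℝ := fun j => (if j = h then 0 else 1,
    -(1 + ((if j = h then d + 1 else j : ℕ) : ℝ) * H)) with ho
  have hoy : ∀ j, (o j).2 ≤ 0 := by
    intro j
    have := mul_nonneg (Nat.cast_nonneg (α := ℝ) (if j = h then d + 1 else (j : ℕ))) hHpos.le
    simp only [ho]
    linarith
  have hcol : ∀ j u, (gluePos p o (.sub j u)).1 = (if j = h then 0 else 1) + (p j u).1 :=
    fun j u => rfl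
  refine ⟨gluePos p o, isPlanar_straight_gluePos hp hroot (fun j u => (hx j u).1) hy hHpos hyH
    (fun j => rfl) (fun j => rfl), ?_, rfl, ?_, ?_, ?_⟩
  · intro e
    refine List.pairwise_pair.2 ?_
    rcases e.eq_top_or_eq_sub with ⟨i, rfl⟩ | ⟨i, e, rfl⟩
    · change (o i + p i (.root _)).2 ≤ 0
      rw [hroot, add_zero]
      exact hoy i
    · have he : (p i e.child).2 ≤ (p i e.parent).2 :=
        (List.pairwise_cons.1 (hup i e)).1 _ (List.mem_singleton_self _)
      exact add_le_add_right he _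
  · rintro (_ | ⟨i, u⟩)
    · exact le_rfl
    · exact add_nonpos (hoy i) (hy i u)
  · rintro (_ | ⟨i, u⟩)
    · refine ⟨le_rfl, ?_⟩
      have h1 := hx m (.root _)
      have h2 := hle m
      change (0 : ℤ) + 1 ≤ _
      omega
    · rw [hcol]
      have h1 := hx i u
      have h2 := hle i
      split_ifs at h2 ⊢ <;> omega
  · obtain ⟨u, hu⟩ := hwit m
    refine ⟨.sub m u, ?_⟩
    rw [hcol]
    split_ifs at hm ⊢ <;> omega

/-- Every tree has an unordered planar upward drawing whose width is its rooted pathwidth. -/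
theorem exists_width_eq_rpw (T : PlaneTree) :
    ∃ D : PolyDrawing T, D.IsPlanar ∧ D.IsUpward ∧ D.width = T.rpw := by
  obtain ⟨p, hp, hup, hroot, -, hx, u, hu⟩ := exists_straight_drawing T
  refine ⟨straight p, hp, hup, ?_⟩
  have hfit : (straight p).FitsColumns T.rpw := by
    refine ⟨-1, fun v => ?_, fun e q hq => by cases hq⟩
    have : 0 ≤ (p v).1 ∧ (p v).1 + 1 ≤ T.rpw := hx v
    change -1 + 1 ≤ (p v).1 ∧ (p v).1 ≤ -1 + T.rpw
    omega
  refine le_antisymm (Nat.sInf_le hfit) (le_csInf ⟨_, hfit⟩ ?_)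
  rintro W ⟨a, ha, -⟩
  have h1 : a + 1 ≤ (p (.root T)).1 ∧ _ := ha (.root T)
  have h2 : _ ∧ (p u).1 ≤ a + W := ha u
  rw [hroot] at h1
  have h3 : a + 1 ≤ 0 := h1.1
  omega

theorem exists_fitsColumns {T : PlaneTree} (D : PolyDrawing T) : ∃ W, D.FitsColumns W := by
  have hfin : {n : ℤ | ∃ u, n ∈ (D.rootPath u).map Prod.fst}.Finite := by
    rw [Set.ofPred_exists]
    exact Set.finite_iUnion fun u => List.finite_toSet _
  obtain ⟨b, hb⟩ := hfin.bddAbove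
  obtain ⟨a, ha⟩ := hfin.bddBelow
  have key : ∀ u, ∀ p ∈ D.rootPath u, a - 1 + 1 ≤ p.1 ∧ p.1 ≤ a - 1 + (b - a + 1).toNat := by
    intro u p hp
    have h1 : p.1 ≤ b := hb ⟨u, List.mem_map_of_mem hp⟩
    have h2 : a ≤ p.1 := ha ⟨u, List.mem_map_of_mem hp⟩
    omega
  exact ⟨(b - a + 1).toNat, a - 1, fun u => key u _ (D.pos_mem_rootPath u),
    fun e p hp => key _ p (D.bends_subset_rootPath e hp)⟩

theorem le_width_of_needsColumns {T : PlaneTree} {n : ℕ} (h : T.NeedsColumns n)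
    {D : PolyDrawing T} (hD : D.IsPlanar) (hU : D.IsUpward) (hO : D.IsOrderPreserving) :
    n ≤ D.width := by
  refine le_csInf D.exists_fitsColumns ?_
  rintro W ⟨a, ha⟩
  have := h D hD hU hO _ _ ha
  omega

end PolyDrawing

/-! ### The trees -/

namespace PlaneTree

/-- The root has two children, both with subtree `T`. -/
def cherry (T : PlaneTree) : PlaneTree := node 2 fun _ => T

/-- The root has five children; the middle one has subtree `cherry T`, the others have
subtree `T`. -/
def fan (T : PlaneTree) : PlaneTree := node 5 fun j => if j = 2 then cherry T else T

/-- `fan` iterated `n` times, starting from a single node. -/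
def iteratedFan : ℕ → PlaneTree
  | 0 => node 0 Fin.elim0
  | n + 1 => fan (iteratedFan n)

theorem deg_le_of_children {d m : ℕ} {c : Fin d → PlaneTree} (hd : d ≤ m)
    (h : ∀ i (u : Node (c i)), u.deg ≤ m) : ∀ u : Node (node d c), u.deg ≤ m
  | .root _ => hd
  | .sub i u => h i u

theorem deg_iteratedFan_le : ∀ (n : ℕ) (u : (iteratedFan n).Node), u.deg ≤ 5
  | 0 => deg_le_of_children (Nat.zero_le _) fun i => i.elim0
  | n + 1 => by
    refine deg_le_of_children le_rfl fun i => ?_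
    by_cases hi : i = 2
    · rw [if_pos hi]
      exact deg_le_of_children (by norm_num) fun _ => deg_iteratedFan_le n
    · rw [if_neg hi]
      exact deg_iteratedFan_le n

theorem rpw_cherry (T : PlaneTree) : (cherry T).rpw = T.rpw + 1 := by
  refine le_antisymm (Finset.inf'_le_of_le _ (Finset.mem_univ 0) ?_)
    (Finset.le_inf' _ _ fun h _ => ?_)
  · exact Finset.sup_le fun i _ => by dsimp only; split_ifs <;> omega
  · obtain ⟨i, hi⟩ := exists_ne h
    exact Finset.le_sup_of_le (Finset.mem_univ i) (by dsimp only; rw [if_neg hi])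

theorem rpw_fan (T : PlaneTree) : (fan T).rpw = T.rpw + 1 := by
  refine le_antisymm (Finset.inf'_le_of_le _ (Finset.mem_univ 2) ?_)
    (Finset.le_inf' _ _ fun h _ => ?_)
  · refine Finset.sup_le fun i _ => ?_
    dsimp only
    split_ifs
    · rw [rpw_cherry, add_zero]
    · exact le_rfl
  · obtain ⟨i, hi⟩ := exists_ne h
    refine Finset.le_sup_of_le (Finset.mem_univ i) ?_
    dsimp only
    rw [if_neg hi]
    split_ifs
    · rw [rpw_cherry]
      omega
    · exact le_rfl

theorem rpw_iteratedFan : ∀ n, (iteratedFan n).rpw = n + 1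
  | 0 => rfl
  | n + 1 => by rw [iteratedFan, rpw_fan, rpw_iteratedFan n]

theorem needsColumns_iteratedFan : ∀ n, (iteratedFan n).NeedsColumns (2 * n + 1)
  | 0 => needsColumns_one _
  | n + 1 => by
    have h := needsColumns_iteratedFan n
    have h' : (cherry (iteratedFan n)).NeedsColumns (2 * n + 1 + 1) :=
      needsColumns_of_two (i := 0) (j := 1) (by decide) h h
    exact needsColumns_of_five (i := 0) (j := 1) (s := 2) (k := 3) (l := 4) (by decide)
      (by decide) (by decide) (by decide) (by omega) h h h' h h

/-! ### Ranks of the trees -/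

/-- Big children of rank at least `m` have distinct bounds in `{m, …, W}`. -/
theorem card_add_le_of_injOn {d W m : ℕ} {r : Fin d → ℕ} {S big : Finset (Fin d)} (hS : S ⊆ big)
    (hne : S.Nonempty) (hm : ∀ i ∈ S, m ≤ r i) {π : Fin d → ℕ} (hinj : Set.InjOn π big)
    (hπ : ∀ i ∈ big, 1 ≤ π i ∧ π i ≤ W ∧ r i ≤ π i) : S.card + m ≤ W + 1 := by
  have h1 : S.card ≤ (Finset.Icc m W).card := by
    refine Finset.card_le_card_of_injOn π (fun i hi => ?_) (hinj.mono (by exact_mod_cast hS))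
    have := hπ i (hS hi)
    have := hm i hi
    simp only [Finset.coe_Icc, Set.mem_Icc]
    omega
  rw [Nat.card_Icc] at h1
  have := hne.card_pos
  omega

theorem sInf_eq_of_least {S : Set ℕ} {n : ℕ} (h : n ∈ S) (h' : ∀ m ∈ S, n ≤ m) : sInf S = n :=
  le_antisymm (Nat.sInf_le h) (le_csInf ⟨n, h⟩ h')

theorem rank_cherry {T : PlaneTree} (hT : 1 ≤ T.rank) : (cherry T).rank = T.rank + 1 := by
  set r := T.rank with hr
  refine sInf_eq_of_least (S := {W | HasRankWitness (fun _ : Fin 2 => T.rank) W}) ?_ ?_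
  · rw [← hr]
    refine ⟨Finset.univ, 1, 0, le_rfl, by omega, Finset.mem_univ _, ?_, ?_, by simp, by simp,
      fun j => r + j, ?_, ?_⟩
    · simp
    · rw [show (Finset.univ.filter ((0 : Fin 2) < ·)).card = 1 from rfl]
      omega
    · intro i _ j _ hij
      exact Fin.ext (Nat.add_left_cancel hij)
    · intro i _
      dsimp only
      omega
  · rintro W ⟨big, X, v, h1X, hXW, hv, -, -, hleft, hright, π, hinj, hπ⟩
    dsimp only at hleft hright hπ
    rw [← hr] at hleft hright hπ
    by_cases hall : big = Finset.univ
    · have := card_add_le_of_injOn (m := r) (subset_refl big) ⟨v, hv⟩ (fun _ _ => le_rfl) hinj hπ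
      rw [hall, Finset.card_univ, Fintype.card_fin] at this
      omega
    · obtain ⟨i, hi⟩ : ∃ i, i ∉ big := by rwa [Finset.eq_univ_iff_forall, not_forall] at hall
      rcases lt_trichotomy i v with h | rfl | h
      · have := hleft i hi h
        omega
      · exact absurd hv hi
      · have := hright i hi h
        omega

theorem rank_fan {T : PlaneTree} (hT : 1 ≤ T.rank) : (fan T).rank = T.rank + 2 := by
  have hmid : (if (2 : Fin 5) = 2 then cherry T else T).rank = T.rank + 1 := by
    rw [if_pos rfl, rank_cherry hT]
  have hside : ∀ j : Fin 5, j ≠ 2 → (if j = 2 then cherry T else T).rank = T.rank := by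
    intro j hj
    rw [if_neg hj]
  have hge : ∀ j : Fin 5, T.rank ≤ (if j = 2 then cherry T else T).rank := by
    intro j
    by_cases hj : j = 2
    · rw [hj, hmid]
      omega
    · rw [hside j hj]
  refine sInf_eq_of_least
    (S := {W | HasRankWitness (fun j : Fin 5 => (if j = 2 then cherry T else T).rank) W}) ?_ ?_
  · -- the last child is vertical, in the last column; the middle one is the only other big child
    have hsmall : ∀ i ∉ ({2, 4} : Finset (Fin 5)), i < 4 ∧ i ≠ 2 ∧
        (({2, 4} : Finset (Fin 5)).filter (· < i)).card ≤ 1 := by decide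
    refine ⟨{2, 4}, T.rank + 2, 4, by omega, le_rfl, by simp, ?_, ?_, ?_, ?_,
      fun j => if j = 2 then T.rank + 1 else T.rank + 2, ?_, ?_⟩
    · rw [show (({2, 4} : Finset (Fin 5)).filter (· < 4)).card = 1 from rfl]
      omega
    · rw [show (({2, 4} : Finset (Fin 5)).filter (4 < ·)).card = 0 from rfl]
      omega
    · intro i hi _
      have := hsmall i hi
      dsimp only
      rw [hside i this.2.1]
      omega
    · intro i hi hlt
      exact absurd hlt (hsmall i hi).1.not_gt
    · intro i hi j hj hij
      have hi' : i = 2 ∨ i = 4 := by simpa using hi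
      have hj' : j = 2 ∨ j = 4 := by simpa using hj
      rcases hi' with rfl | rfl <;> rcases hj' with rfl | rfl <;> simp at hij ⊢
    · intro i hi
      have hi' : i = 2 ∨ i = 4 := by simpa using hi
      rcases hi' with rfl | rfl
      · dsimp only
        rw [hmid, if_pos rfl]
        omega
      · have := hside 4 (by decide)
        dsimp only
        rw [this, if_neg (by decide)]
        omega
  · rintro W ⟨big, X, v, h1X, hXW, hv, -, -, hleft, hright, π, hinj, hπ⟩
    by_contra! hW
    dsimp only at hleft hright hπ
    have hcard : big.card ≤ 2 := by
      have := card_add_le_of_injOn (subset_refl big) ⟨v, hv⟩ (fun i _ => hge i) hinj hπ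
      omega
    have h2 : (2 : Fin 5) ∈ big := by
      by_contra h2
      rcases lt_trichotomy 2 v with h | rfl | h
      · have := hleft 2 h2 h
        omega
      · exact h2 hv
      · have := hright 2 h2 h
        omega
    have hthree : ∀ i j : Fin 5, i ≠ j → i ≠ 2 → j ≠ 2 → i ∈ big → j ∉ big := by
      intro i j hij hi hj hib hjb
      have hsub : ({i, j, 2} : Finset (Fin 5)) ⊆ big := by
        simp [Finset.insert_subset_iff, hib, hjb, h2]
      have := Finset.card_le_card hsub
      rw [Finset.card_eq_three.2 ⟨i, j, 2, hij, hi, hj, rfl⟩] at this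
      omega
    have hl : ∀ i : Fin 5, i ≠ 2 → i ∉ big → i < v →
        T.rank + 1 + (big.filter (· < i)).card ≤ X := by
      intro i hi hib hiv
      have := hleft i hib hiv
      rwa [hside i hi] at this
    have hr : ∀ i : Fin 5, i ≠ 2 → i ∉ big → v < i →
        T.rank + X + (big.filter (i < ·)).card ≤ W := by
      intro i hi hib hiv
      have := hright i hib hiv
      rwa [hside i hi] at this
    -- small children on both sides of the vertical child leave no column for it
    have hboth : ∀ i j : Fin 5, i ≠ 2 → j ≠ 2 → i ∉ big → j ∉ big → i < v → v < j → False := by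
      intro i j hi hj hib hjb hiv hvj
      have := hl i hi hib hiv
      have := hr j hj hjb hvj
      omega
    fin_cases v
    · have h1 := hr 1 (by decide) (hthree 0 1 (by decide) (by decide) (by decide) hv) (by decide)
      have : 0 < (big.filter ((1 : Fin 5) < ·)).card :=
        Finset.card_pos.2 ⟨2, Finset.mem_filter.2 ⟨h2, by decide⟩⟩
      omega
    · exact hboth 0 3 (by decide) (by decide)
        (hthree 1 0 (by decide) (by decide) (by decide) hv)
        (hthree 1 3 (by decide) (by decide) (by decide) hv) (by decide) (by decide)
    · obtain ⟨i, hi, hi2, hib⟩ : ∃ i : Fin 5, i < 2 ∧ i ≠ 2 ∧ i ∉ big := by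
        by_cases h0 : (0 : Fin 5) ∈ big
        · exact ⟨1, by decide, by decide, hthree 0 1 (by decide) (by decide) (by decide) h0⟩
        · exact ⟨0, by decide, by decide, h0⟩
      obtain ⟨j, hj, hj2, hjb⟩ : ∃ j : Fin 5, 2 < j ∧ j ≠ 2 ∧ j ∉ big := by
        by_cases h3 : (3 : Fin 5) ∈ big
        · exact ⟨4, by decide, by decide, hthree 3 4 (by decide) (by decide) (by decide) h3⟩
        · exact ⟨3, by decide, by decide, h3⟩
      exact hboth i j hi2 hj2 hib hjb hi hj
    · exact hboth 0 4 (by decide) (by decide)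
        (hthree 3 0 (by decide) (by decide) (by decide) hv)
        (hthree 3 4 (by decide) (by decide) (by decide) hv) (by decide) (by decide)
    · have h1 := hl 3 (by decide) (hthree 4 3 (by decide) (by decide) (by decide) hv) (by decide)
      have : 0 < (big.filter (· < (3 : Fin 5))).card :=
        Finset.card_pos.2 ⟨2, Finset.mem_filter.2 ⟨h2, by decide⟩⟩
      omega

theorem rank_iteratedFan : ∀ n, (iteratedFan n).rank = 2 * n + 1
  | 0 => by rw [iteratedFan, rank]
  | n + 1 => by
    have h := rank_iteratedFan n
    rw [iteratedFan, rank_fan (by omega), h]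
    omega

end PlaneTree

theorem mainTheorem3 (i : ℕ) (hi : 1 ≤ i) :
    ∃ T : PlaneTree,
      -- the degree is at most 5, and it is 5 except for `i = 1`
      ((∀ u : T.Node, u.deg ≤ 5) ∧ (2 ≤ i → ∃ u : T.Node, u.deg = 5)) ∧
      -- there is an unordered planar upward drawing of width `i`
      (∃ D : PolyDrawing T, D.IsPlanar ∧ D.IsUpward ∧ D.width = i) ∧
      T.rpw ≤ i ∧
      T.rank = 2 * i - 1 ∧
      -- order-preserving planar upward drawings have width at least `2 * i - 1`
      (∀ D : PolyDrawing T, D.IsPlanar → D.IsUpward → D.IsOrderPreserving →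
        2 * i - 1 ≤ D.width) := by
  obtain ⟨n, rfl⟩ := Nat.exists_eq_add_of_le' hi
  refine ⟨PlaneTree.iteratedFan n, ⟨PlaneTree.deg_iteratedFan_le n, fun h => ?_⟩, ?_, (PlaneTree.rpw_iteratedFan n).le, ?_,
    fun D hD hU hO => ?_⟩
  · obtain ⟨m, rfl⟩ := Nat.exists_eq_succ_of_ne_zero (show n ≠ 0 by omega)
    exact ⟨.root _, rfl⟩
  · obtain ⟨D, hD, hU, hw⟩ := PolyDrawing.exists_width_eq_rpw (PlaneTree.iteratedFan n)
    exact ⟨D, hD, hU, hw.trans (PlaneTree.rpw_iteratedFan n)⟩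
  · rw [PlaneTree.rank_iteratedFan]
    omega
  · have := PolyDrawing.le_width_of_needsColumns (PlaneTree.needsColumns_iteratedFan n) hD hU hO
    omega
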